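/- **Theorem 1 (Spectrum without zero mode).** Let $\Omega\subset\mathbb R^d$ be a bounded open set and let a homogeneous boundary condition for $-\Delta$ on $\Omega$ be given by its form domain, a closed subspace $V$ with $H^1_0(\Omega)\subseteq V\subseteq H^1(\Omega)$ (for instance $V=H_0^1(\Omega)$ for Dirichlet conditions, or the functions vanishing on a part of $\partial\Omega$ for mixed Dirichlet–Neumann conditions). Assume that $\Omega$ is regular enough that there is a constant $C$ such that every $u\in V$ is the restriction to $\Omega$ of some $U\in H^1(\mathbb R^d)$ with $\|U\|_{H^1(\mathbb R^d)}\le C\|u\|_{H^1(\Omega)}$ (this holds for $V=H_0^1(\Omega)$ on any $\Omega$, and for every $V$ on Lipschitz domains). Let $\Sigma>0$ be a bounded measurable density on $\Omega$. A mode with eigenvalue $E\in\mathbb R$ is a nonzero $\Psi\in V$ with $-\Delta\Psi=E\,\Sigma\,\Psi$ weakly, i.e. $\int_\Omega\nabla\Psi\cdot\nabla v=E\int_\Omega\Sigma\Psi v$ for all $v\in V$. Assume that there is no zero mode (mode with $E=0$). Let $G$ be the Green's function of the homogeneous problem with the same boundary condition, that is, a measurable function on $\Omega\times\Omega$ such that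 $\int_\Omega G(x,y)f(y)\,dy$ converges absolutely for every $f\in L^2(\Omega)$ and almost every $x$, and $-\Delta_xG(x,y)=\delta(x-y)$: for every $f\in C_c^\infty(\Omega)$ the function $u=\int_\Omega G(\cdot,y)f(y)\,dy$ lies in $V$ and $\int_\Omega\nabla u\cdot\nabla v=\int_\Omega fv$ for all $v\in V$. For $\Xi^{(0)}\in L^2(\Omega)$ put $$\Xi^{(p)}(x)=\sqrt{\Sigma(x)}\int_\Omega G(x,y)\sqrt{\Sigma(y)}\;\Xi^{(p-1)}(y)\,dy ,\qquad p\ge1 .$$ The overlap of $\Xi^{(0)}$ with a mode $\Psi$ is $\int_\Omega\sqrt\Sigma\,\Psi\,\Xi^{(0)}$. Below, convergence means convergence in $L^2(\Omega)$ and pointwise almost everywhere in $\Omega$, and $\|\cdot\|$ is the norm of $L^2(\Omega)$. Then: 1. The map $h\mapsto\sqrt{\Sigma}\int_\Omega G(\cdot,y)\sqrt{\Sigma(y)}\,h(y)\,dy$ on $L^2(\Omega)$ is the inverse of $\hat O=\Sigma^{-1/2}(-\Delta)\Sigma^{-1/2}$: a function $f$ equals its value at $h\in L^2(\Omega)$ almost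 everywhere if and only if $f/\sqrt\Sigma\in V$ and $-\Delta(f/\sqrt\Sigma)=\sqrt\Sigma\,h$ weakly in $V$. All eigenvalues are positive, and if $\Omega\neq\emptyset$ there is a smallest one. All $\Xi^{(p)}$ are well defined and in $L^2(\Omega)$. 2. If $\Xi^{(0)}\ne0$ in $L^2(\Omega)$, there is a smallest eigenvalue $E$ having a mode with nonzero overlap with $\Xi^{(0)}$, and there is a mode $\Psi$ with eigenvalue $E$, for which $\sqrt\Sigma\,\Psi$ is the orthogonal projection of $\Xi^{(0)}$ on $\{\sqrt\Sigma\,\Psi':\Psi'=0\text{ or }\Psi'\text{ a mode with eigenvalue }E\}$, such that, as $p\to\infty$, $$E^p\,\Xi^{(p)}\to\sqrt\Sigma\,\Psi,\qquad E^p\,\frac{\Xi^{(p)}}{\sqrt\Sigma}\to\Psi,\qquad \frac{\Xi^{(p)}}{\|\Xi^{(p)}\|}\to\frac{\sqrt\Sigma\,\Psi}{\|\sqrt\Sigma\,\Psi\|},\qquad \frac{\Xi^{(p)}}{\|\Xi^{(p)}\|\sqrt\Sigma}\to\frac{\Psi}{\|\sqrt\Sigma\,\Psi\|}.$$ 3.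 In particular, if $\Xi^{(0)}$ has nonzero overlap with a mode $\Psi_0$ of the smallest eigenvalue $E_0$, these four limits hold with $E=E_0$ and some mode $\Psi$ with eigenvalue $E_0$. If moreover this fundamental mode is unique up to a constant factor and normalized by $\int_\Omega\Sigma\Psi_0^2=1$, they hold with $\Psi=c\,\Psi_0$, where $c=\int_\Omega\sqrt\Sigma\,\Psi_0\,\Xi^{(0)}$; in particular $$\Psi_0=\lim_{p\to\infty}\operatorname{sign}(c)\,\frac{\Xi^{(p)}}{\|\Xi^{(p)}\|\sqrt\Sigma}.$$ -/

import Mathlib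

open MeasureTheory Filter Topology
open scoped ContDiff

/-- The Euclidean space `ℝᵈ`. -/
abbrev Eu (d : ℕ) : Type := EuclideanSpace ℝ (Fin d)

/-- Lebesgue measure on the region `Ω`. -/
noncomputable abbrev vol {d : ℕ} (Ω : Set (Eu d)) : Measure (Eu d) := volume.restrict Ω

/-- The Hilbert space `L²(Ω) × L²(Ω; ℝᵈ)`, with norm `(‖u‖² + ‖g‖²)^{1/2}`.  An element of `H¹(Ω)` is
represented by the pair `(u, ∇u)`, so that the norm of the pair is the `H¹` norm of `u`. -/
abbrev GradPair {d : ℕ} (Ω : Set (Eu d)) : Type :=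
  WithLp 2 (Lp ℝ 2 (vol Ω) × Lp (Eu d) 2 (vol Ω))

/-- `φ ∈ C_c^∞(Ω)`. -/
def IsTest {d : ℕ} (Ω : Set (Eu d)) (φ : Eu d → ℝ) : Prop :=
  ContDiff ℝ ∞ φ ∧ HasCompactSupport φ ∧ tsupport φ ⊆ Ω

/-- The Sobolev space `H¹(Ω)`: the pairs `(u, g)` such that `g` is the weak gradient of `u`. -/
def sobolevH1 {d : ℕ} (Ω : Set (Eu d)) : Set (GradPair Ω) :=
  {w | ∀ φ : Eu d → ℝ, IsTest Ω φ → ∀ e : Eu d,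
    ∫ x in Ω, w.fst x * fderiv ℝ φ x e = - ∫ x in Ω, inner ℝ (w.snd x) e * φ x}

/-- The space `H¹₀(Ω)`: the closure in the `H¹` norm of the test functions. -/
def sobolevH10 {d : ℕ} (Ω : Set (Eu d)) : Set (GradPair Ω) :=
  closure {w | ∃ φ : Eu d → ℝ, IsTest Ω φ ∧
    (w.fst : Eu d → ℝ) =ᵐ[vol Ω] φ ∧ (w.snd : Eu d → Eu d) =ᵐ[vol Ω] gradient φ}

/-- A homogeneous boundary condition for `-Δ` on `Ω`, given by its form domain: a closed
subspace `V` with `H¹₀(Ω) ⊆ V ⊆ H¹(Ω)`.  `V = H¹₀(Ω)` is the Dirichlet condition, `V = H¹(Ω)` the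
Neumann condition, and the functions of `H¹(Ω)` vanishing on a part of the boundary give the mixed
Dirichlet-Neumann condition; periodic functions give the periodic one. -/
def IsBoundaryCondition {d : ℕ} (Ω : Set (Eu d)) (V : Submodule ℝ (GradPair Ω)) : Prop :=
  IsClosed (V : Set (GradPair Ω)) ∧ sobolevH10 Ω ⊆ V ∧ (V : Set (GradPair Ω)) ⊆ sobolevH1 Ω

/-- Regularity of the region relative to the boundary condition: the functions in `V` are
restrictions of functions in `H¹(ℝᵈ)`, with control of the norm.  For `V = H¹₀(Ω)` extension by zero
does this on every `Ω`; on a Lipschitz domain it holds for every `V`. -/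
def HasExtension {d : ℕ} (Ω : Set (Eu d)) (V : Submodule ℝ (GradPair Ω)) : Prop :=
  ∃ C : ℝ, ∀ w ∈ V, ∃ W ∈ sobolevH1 (Set.univ : Set (Eu d)),
    (W.fst : Eu d → ℝ) =ᵐ[vol Ω] w.fst ∧ ‖W‖ ≤ C * ‖w‖

/-- `u ∈ V` is the weak solution of `-Δ u = f` on `Ω` with the boundary condition `V`. -/
def SolvesPoisson {d : ℕ} (Ω : Set (Eu d)) (V : Submodule ℝ (GradPair Ω))
    (u : GradPair Ω) (f : Eu d → ℝ) : Prop :=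
  u ∈ V ∧ ∀ v ∈ V, ∫ x in Ω, inner ℝ (u.snd x) (v.snd x) = ∫ x in Ω, f x * v.fst x

/-- `Ψ` is a mode with eigenvalue `E` of the Helmholtz equation `-Δ Ψ = E σ Ψ`, with density `σ` and
boundary condition `V`. -/
def IsMode {d : ℕ} (Ω : Set (Eu d)) (V : Submodule ℝ (GradPair Ω)) (σ : Eu d → ℝ)
    (E : ℝ) (Ψ : GradPair Ω) : Prop :=
  Ψ.fst ≠ 0 ∧ SolvesPoisson Ω V Ψ (fun x => E * σ x * Ψ.fst x)

/-- `G` is a Green's function of the homogeneous problem with boundary condition `V`: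
`-Δ_x G(x, y) = δ(x - y)`, in the weak sense in `x`, and as a distribution in `y`, that is, after
integration against test functions `f(y)`.  It is also required that `∫ G(x, y) f(y) dy` makes sense
for square integrable `f` and almost every `x`. -/
def IsGreen {d : ℕ} (Ω : Set (Eu d)) (V : Submodule ℝ (GradPair Ω))
    (G : Eu d → Eu d → ℝ) : Prop :=
  AEStronglyMeasurable (Function.uncurry G) ((vol Ω).prod (vol Ω)) ∧
  (∀ f : Eu d → ℝ, MemLp f 2 (vol Ω) →
    ∀ᵐ x ∂(vol Ω), Integrable (fun y => G x y * f y) (vol Ω)) ∧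
  ∀ f : Eu d → ℝ, IsTest Ω f → ∃ u : GradPair Ω,
    (u.fst : Eu d → ℝ) =ᵐ[vol Ω] (fun x => ∫ y in Ω, G x y * f y) ∧ SolvesPoisson Ω V u f

/-- `f` is in the domain of `Ô = σ^{-1/2} (-Δ) σ^{-1/2}` and `Ô f = h`: the function
`u = f / √σ` is in `V` and `-Δ u = √σ h`. -/
def IsOhat {d : ℕ} (Ω : Set (Eu d)) (V : Submodule ℝ (GradPair Ω)) (σ : Eu d → ℝ)
    (f h : Eu d → ℝ) : Prop :=
  ∃ u : GradPair Ω, f =ᵐ[vol Ω] (fun x => √(σ x) * u.fst x) ∧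
    SolvesPoisson Ω V u (fun x => √(σ x) * h x)

/-- One step of the iteration: `f ↦ √σ(x) ∫_Ω G(x, y) √σ(y) f(y) dy`. -/
noncomputable def greenStep {d : ℕ} (Ω : Set (Eu d)) (σ : Eu d → ℝ) (G : Eu d → Eu d → ℝ)
    (f : Eu d → ℝ) : Eu d → ℝ :=
  fun x => √(σ x) * ∫ y in Ω, G x y * (√(σ y) * f y)

/-- The sequence `Ξ^{(p)}` started at `Ξ^{(0)} = Ξ₀`. -/
noncomputable def xiSeq {d : ℕ} (Ω : Set (Eu d)) (σ : Eu d → ℝ) (G : Eu d → Eu d → ℝ)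
    (Ξ₀ : Eu d → ℝ) : ℕ → Eu d → ℝ
  | 0 => Ξ₀
  | p + 1 => greenStep Ω σ G (xiSeq Ω σ G Ξ₀ p)

/-- The overlap `∫_Ω Φ Ξ₀` of `Ξ₀` with a mode `Ψ`, where `Φ = √σ Ψ`. -/
noncomputable def overlap {d : ℕ} (Ω : Set (Eu d)) (σ : Eu d → ℝ) (Ψ : GradPair Ω)
    (Ξ₀ : Eu d → ℝ) : ℝ :=
  ∫ x in Ω, (√(σ x) * Ψ.fst x) * Ξ₀ x

/-- The norm of `L²(Ω)`. -/
noncomputable def l2norm {d : ℕ} (Ω : Set (Eu d)) (f : Eu d → ℝ) : ℝ :=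
  √(∫ x in Ω, f x ^ 2)

/-- Convergence in `L²(Ω)` and pointwise almost everywhere on `Ω`. -/
def Converges {d : ℕ} (Ω : Set (Eu d)) (F : ℕ → Eu d → ℝ) (f : Eu d → ℝ) : Prop :=
  Tendsto (fun p => eLpNorm (fun x => F p x - f x) 2 (vol Ω)) atTop (𝓝 0) ∧
  ∀ᵐ x ∂(vol Ω), Tendsto (fun p => F p x) atTop (𝓝 (f x))

/-- The sequence `Ξ p` converges to `Φ = √σ Ψ`, and `Ξ p / √σ` to `Ψ`, up to normalization: after
multiplication by `E ^ p`, and also after division by the norm of `Ξ p` (the limit being then the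
normalized mode). -/
def ConvergesToMode {d : ℕ} (Ω : Set (Eu d)) (σ : Eu d → ℝ) (Ξ : ℕ → Eu d → ℝ)
    (E : ℝ) (Ψ : Eu d → ℝ) : Prop :=
  Converges Ω (fun p x => E ^ p * Ξ p x) (fun x => √(σ x) * Ψ x) ∧
  Converges Ω (fun p x => E ^ p * (Ξ p x / √(σ x))) Ψ ∧
  Converges Ω (fun p x => Ξ p x / l2norm Ω (Ξ p))
    (fun x => √(σ x) * Ψ x / l2norm Ω (fun y => √(σ y) * Ψ y)) ∧
  Converges Ω (fun p x => Ξ p x / √(σ x) / l2norm Ω (Ξ p))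
    (fun x => Ψ x / l2norm Ω (fun y => √(σ y) * Ψ y))

/-! In the unknown `√σ Ψ`, the equation `-Δ Ψ = E σ Ψ` becomes an eigenvalue equation for `T = √σ S
√σ`, with eigenvalue `1/E`, where `S` solves the Poisson problem in `V`. The theorem is power
iteration for `T`, once `T` is known to be compact, positive and injective, and once one step of the
iteration is known to be an application of `T`.

Compactness of `V → L²` is Rellich's theorem (`totallyBounded_of_extension`): a function of `H¹(ℝᵈ)`
changes little in `L²` under a small translation, so averages over a fine grid approximate it
uniformly on bounded sets. Without a zero mode, compactness gives Poincaré's inequality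
(`exists_norm_sq_le_norm_grad_sq`), and Lax-Milgram gives `S`. Positivity comes from symmetry of the
Dirichlet form, injectivity from the density of test functions. The kernel `G` is only tested on
smooth functions; dominated convergence extends its agreement with `S` to all of `L²`
(`integral_green_eq_solver`).

For the iteration (`exists_power_iteration_limit`), `T` is restricted to the closed cyclic subspace
of `ξ`. Its norm there is an eigenvalue `μ`, the largest one that `ξ` sees. On the complement of the
`μ`-eigenspace in that subspace the norm is some `ν < μ`, so the error decays like `(ν/μ)^p`. This
geometric rate makes the errors summable, which gives almost everywhere convergence of the whole
sequence in addition to `L²` convergence. -/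

/-! ### Power iteration for compact positive operators -/

section PowerIteration

variable {H : Type*} [NormedAddCommGroup H] [InnerProductSpace ℝ H] [CompleteSpace H]

/-- The norm of a positive compact operator is an eigenvalue. -/
theorem hasEigenvalue_norm_of_isCompactOperator {A : H →L[ℝ] H} (hA : IsCompactOperator A)
    (hpos : A.IsPositive) (h0 : A ≠ 0) :
    0 < ‖A‖ ∧ Module.End.HasEigenvalue (A : Module.End ℝ H) ‖A‖ := by
  have hne : ‖A‖ ≠ 0 := norm_ne_zero_iff.2 h0
  refine ⟨(norm_nonneg A).lt_of_ne hne.symm, ?_⟩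
  have : Nontrivial H := by
    by_contra h
    rw [not_nontrivial_iff_subsingleton] at h
    exact h0 (Subsingleton.elim _ _)
  -- Fredholm alternative. If `‖A‖` were in the resolvent set, the Rayleigh quotient would stay
  -- below `‖A‖ - ε`, while for a symmetric operator the supremum of its absolute value is `‖A‖`.
  refine (IsCompactOperator.hasEigenvalue_or_mem_resolventSet hA hne).resolve_right fun hres => ?_
  obtain ⟨ε, hε, hle⟩ := A.rayleighQuotient_le_of_norm_mem_resolventSet hres
  have habs : ∀ x, |A.rayleighQuotient x| ≤ ‖A‖ - ε := fun x => by
    rw [abs_of_nonneg]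
    · exact hle x
    · exact div_nonneg (hpos.2 x) (sq_nonneg _)
  have := A.norm_eq_iSup_rayleighQuotient hpos.isSymmetric
  have h2 : ⨆ x, |A.rayleighQuotient x| ≤ ‖A‖ - ε := ciSup_le habs
  linarith

/-- On a closed invariant subspace, a positive compact operator attains its norm at an
eigenvector. -/
theorem exists_maximal_eigenvector {T : H →L[ℝ] H} (hT : IsCompactOperator T)
    (hpos : T.IsPositive) (W : Submodule ℝ H) (hW : IsClosed (W : Set H))
    (hinv : ∀ x ∈ W, T x ∈ W) (hne : ∃ x ∈ W, T x ≠ 0) :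
    ∃ μ : ℝ, 0 < μ ∧ (∃ w ∈ W, w ≠ 0 ∧ T w = μ • w) ∧ ∀ x ∈ W, ‖T x‖ ≤ μ * ‖x‖ := by
  have : CompleteSpace W := hW.completeSpace_coe
  let A : W →L[ℝ] W := T.restrict hinv
  have hA : IsCompactOperator A := hT.restrict' hinv
  have hApos : A.IsPositive :=
    ⟨fun x y => hpos.1 x y, fun x => hpos.2 x⟩
  have hA0 : A ≠ 0 := by
    obtain ⟨x, hx, hTx⟩ := hne
    intro h
    apply hTx
    have := congrArg (fun B : W →L[ℝ] W => ((B ⟨x, hx⟩ : W) : H)) h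
    simpa [A] using this
  obtain ⟨hnorm, heig⟩ := hasEigenvalue_norm_of_isCompactOperator hA hApos hA0
  obtain ⟨w, hw⟩ := heig.exists_hasEigenvector
  refine ⟨‖A‖, hnorm, ⟨w, w.2, ?_, ?_⟩, fun x hx => ?_⟩
  · simpa using hw.2
  · have := congrArg (fun z : W => (z : H)) hw.apply_eq_smul
    simpa [A] using this
  · exact A.le_opNorm ⟨x, hx⟩

/-- Power iteration for an injective positive compact operator: the rescaled iterates of `ξ ≠ 0`
converge at a geometric rate to the component of `ξ` in the eigenspace of the largest eigenvalue
that has an eigenvector not orthogonal to `ξ`. -/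
theorem exists_power_iteration_limit {T : H →L[ℝ] H} (hT : IsCompactOperator T)
    (hpos : T.IsPositive) (hinj : ∀ x, T x = 0 → x = 0) {ξ : H} (hξ : ξ ≠ 0) :
    ∃ μ : ℝ, 0 < μ ∧ ∃ φ : H, φ ≠ 0 ∧ T φ = μ • φ ∧
      (∀ w, T w = μ • w → inner ℝ w φ = inner ℝ w ξ) ∧
      (∀ (μ' : ℝ) (w : H), T w = μ' • w → inner ℝ w ξ ≠ 0 → μ' ≤ μ) ∧
      ∃ C r : ℝ, 0 ≤ C ∧ 0 ≤ r ∧ r < 1 ∧ ∀ p : ℕ, ‖μ⁻¹ ^ p • (T ^ p) ξ - φ‖ ≤ C * r ^ p := by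
  have hsymm : ∀ x y, inner ℝ (T x) y = inner ℝ x (T y) := fun x y => hpos.1 x y
  -- The closed cyclic subspace of `ξ`. A nonzero eigenvector in it cannot be orthogonal to `ξ`, so
  -- the top eigenvalue of `T` on `W` is automatically one that `ξ` overlaps.
  let W : Submodule ℝ H := (Submodule.span ℝ (Set.range fun p : ℕ => (T ^ p) ξ)).topologicalClosure
  have hWc : IsClosed (W : Set H) := Submodule.isClosed_topologicalClosure _
  have : CompleteSpace W := hWc.completeSpace_coe
  have horb : ∀ p : ℕ, (T ^ p) ξ ∈ W := fun p =>
    Submodule.le_topologicalClosure _ (Submodule.subset_span ⟨p, rfl⟩)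
  have hξW : ξ ∈ W := horb 0
  have hinv : ∀ x ∈ W, T x ∈ W := by
    have hspan : Submodule.span ℝ (Set.range fun p : ℕ => (T ^ p) ξ)
        ≤ W.comap (T : H →ₗ[ℝ] H) := by
      rw [Submodule.span_le]
      rintro _ ⟨p, rfl⟩
      have := horb (p + 1)
      rw [pow_succ'] at this
      exact this
    have hcl : IsClosed ((W.comap (T : H →ₗ[ℝ] H) : Submodule ℝ H) : Set H) :=
      hWc.preimage T.continuous
    exact fun x hx => Submodule.topologicalClosure_minimal _ hspan hcl hx
  -- an eigenvector orthogonal to `ξ` is orthogonal to `W`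
  have horth : ∀ (μ' : ℝ) (w : H), T w = μ' • w → inner ℝ w ξ = 0 → ∀ x ∈ W, inner ℝ w x = 0 := by
    intro μ' w hw h0 x hx
    have hle : W ≤ (ℝ ∙ w)ᗮ := by
      refine Submodule.topologicalClosure_minimal _ ?_ (Submodule.isClosed_orthogonal _)
      rw [Submodule.span_le]
      rintro _ ⟨p, rfl⟩
      rw [SetLike.mem_coe, Submodule.mem_orthogonal_singleton_iff_inner_right]
      induction p with
      | zero => simpa using h0
      | succ p ih =>
        change inner ℝ w ((T ^ (p + 1)) ξ) = 0
        rw [pow_succ', ContinuousLinearMap.mul_def, ContinuousLinearMap.comp_apply, ← hsymm, hw, inner_smul_left, ih]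
        simp
    exact (Submodule.mem_orthogonal_singleton_iff_inner_right).1 (hle hx)
  obtain ⟨μ, hμ, ⟨w₀, hw₀W, hw₀, hTw₀⟩, hbound⟩ := exists_maximal_eigenvector hT hpos W hWc hinv
    ⟨ξ, hξW, fun h => hξ (hinj _ h)⟩
  -- the projection on `W` maps eigenvectors to eigenvectors
  have hproj : ∀ (μ' : ℝ) (w : H), T w = μ' • w →
      T (W.starProjection w) = μ' • W.starProjection w := by
    intro μ' w hw
    have hmem : T (W.starProjection w) - μ' • W.starProjection w ∈ W :=
      W.sub_mem (hinv _ (W.starProjection_apply_mem w)) (W.smul_mem _ (W.starProjection_apply_mem w))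
    have hz : T (W.starProjection w) - μ' • W.starProjection w =
        μ' • (w - W.starProjection w) - T (w - W.starProjection w) := by
      rw [map_sub, hw]; module
    rw [← sub_eq_zero, ← inner_self_eq_zero (𝕜 := ℝ)]
    set z := T (W.starProjection w) - μ' • W.starProjection w
    have ho : ∀ x ∈ W, inner ℝ (w - W.starProjection w) x = 0 :=
      fun x hx => W.starProjection_inner_eq_zero w x hx
    rw [show inner ℝ z z = inner ℝ (μ' • (w - W.starProjection w) - T (w - W.starProjection w)) z
      by rw [← hz]]
    rw [inner_sub_left, inner_smul_left, hsymm, ho z hmem, ho _ (hinv z hmem)]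
    simp
  have hprojinner : ∀ w, ∀ x ∈ W, inner ℝ (W.starProjection w) x = inner ℝ w x := by
    intro w x hx
    have := W.starProjection_inner_eq_zero w x hx
    rw [inner_sub_left] at this
    linarith
  let F : Submodule ℝ H := W ⊓ Module.End.eigenspace (T : Module.End ℝ H) μ
  have hFmem : ∀ x, x ∈ F ↔ x ∈ W ∧ T x = μ • x := fun x => by
    simp [F]
  have hFc : IsClosed (F : Set H) := by
    have : (F : Set H) = (W : Set H) ∩ {x | T x = μ • x} := by
      ext x; exact hFmem x
    rw [this]
    exact hWc.inter (isClosed_eq T.continuous (continuous_const_smul μ))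
  have : CompleteSpace F := hFc.completeSpace_coe
  -- The invariant complement of the top eigenspace inside `W`; the error `ξ - φ` lives here.
  let X : Submodule ℝ H := W ⊓ Fᗮ
  have hXc : IsClosed (X : Set H) := hWc.inter (Submodule.isClosed_orthogonal F)
  have hXinv : ∀ x ∈ X, T x ∈ X := by
    rintro x ⟨hxW, hxF⟩
    refine ⟨hinv x hxW, fun y hy => ?_⟩
    rw [← hsymm, ((hFmem y).1 hy).2, inner_smul_left, hxF y hy]
    simp
  -- the gap
  obtain ⟨ν, hν0, hνμ, hν⟩ : ∃ ν : ℝ, 0 ≤ ν ∧ ν < μ ∧ ∀ x ∈ X, ‖T x‖ ≤ ν * ‖x‖ := by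
    by_cases hX : ∃ x ∈ X, T x ≠ 0
    · obtain ⟨ν, hν, ⟨v, hvX, hv, hTv⟩, hb⟩ := exists_maximal_eigenvector hT hpos X hXc hXinv hX
      refine ⟨ν, hν.le, lt_of_le_of_ne ?_ ?_, hb⟩
      · have := hbound v hvX.1
        rw [hTv, norm_smul, Real.norm_of_nonneg hν.le] at this
        exact le_of_mul_le_mul_right this (norm_pos_iff.2 hv)
      -- If `ν = μ`, the maximizing eigenvector `v` would lie both in `F` and in its orthogonal
      -- complement.
      · rintro rfl
        have := hvX.2 v ((hFmem v).2 ⟨hvX.1, hTv⟩)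
        exact hv (inner_self_eq_zero.1 this)
    · push Not at hX
      exact ⟨0, le_rfl, hμ, fun x hx => by simp [hX x hx]⟩
  set φ := F.starProjection ξ
  have hφF : φ ∈ F := F.starProjection_apply_mem ξ
  have hφinner : ∀ x ∈ F, inner ℝ x φ = inner ℝ x ξ := by
    intro x hx
    have := F.starProjection_inner_eq_zero ξ x hx
    rw [inner_sub_left] at this
    rw [real_inner_comm, real_inner_comm ξ]
    linarith
  have hρX : ξ - φ ∈ X := by
    refine ⟨W.sub_mem hξW hφF.1, fun y hy => ?_⟩
    rw [inner_sub_right, hφinner y hy, sub_self]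
  have hTφ : T φ = μ • φ := ((hFmem φ).1 hφF).2
  refine ⟨μ, hμ, φ, ?_, hTφ, ?_, ?_, ‖ξ - φ‖, ν / μ, norm_nonneg _, by positivity,
    (div_lt_one hμ).2 hνμ, ?_⟩
  -- If `φ = 0`, the top eigenvector `w₀` is orthogonal to `ξ`, hence to all of `W`, hence to
  -- itself.
  · intro h0
    have h1 := hφinner w₀ ((hFmem w₀).2 ⟨hw₀W, hTw₀⟩)
    rw [h0, inner_zero_right] at h1
    exact hw₀ (inner_self_eq_zero.1 (horth μ w₀ hTw₀ h1.symm w₀ hw₀W))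
  -- An eigenvector `w` need not lie in `W`. Its projection on `W` satisfies the same eigenvalue
  -- equation and has the same inner products with `φ` and `ξ`; this serves here and in the
  -- maximality claim that follows.
  · intro w hw
    rw [← hprojinner w φ hφF.1, ← hprojinner w ξ hξW]
    exact hφinner _ ((hFmem _).2 ⟨W.starProjection_apply_mem w, hproj μ w hw⟩)
  · intro μ' w hw hne
    rw [← hprojinner w ξ hξW] at hne
    have hne0 : W.starProjection w ≠ 0 := fun h => hne (by rw [h, inner_zero_left])
    have := hbound _ (W.starProjection_apply_mem w)
    rw [hproj μ' w hw, norm_smul] at this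
    exact (le_abs_self _).trans (le_of_mul_le_mul_right this (norm_pos_iff.2 hne0))
  · intro p
    have key : ∀ p : ℕ, (T ^ p) (ξ - φ) ∈ X ∧ ‖(T ^ p) (ξ - φ)‖ ≤ ν ^ p * ‖ξ - φ‖ := by
      intro p
      induction p with
      | zero => simpa using hρX
      | succ p ih =>
        rw [pow_succ', ContinuousLinearMap.mul_def, ContinuousLinearMap.comp_apply]
        refine ⟨hXinv _ ih.1, (hν _ ih.1).trans ?_⟩
        rw [pow_succ', mul_assoc]
        exact mul_le_mul_of_nonneg_left ih.2 hν0
    have hpow : ∀ p : ℕ, (T ^ p) φ = μ ^ p • φ := by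
      intro p
      induction p with
      | zero => simp
      | succ p ih =>
        rw [pow_succ', ContinuousLinearMap.mul_def, ContinuousLinearMap.comp_apply, ih, map_smul, hTφ, smul_smul, pow_succ]
    have heq : μ⁻¹ ^ p • (T ^ p) ξ - φ = μ⁻¹ ^ p • (T ^ p) (ξ - φ) := by
      rw [map_sub, hpow, smul_sub, smul_smul, ← mul_pow, inv_mul_cancel₀ hμ.ne', one_pow, one_smul]
    rw [heq, norm_smul, norm_pow, norm_inv, Real.norm_of_nonneg hμ.le, div_pow, inv_pow]
    calc (μ ^ p)⁻¹ * ‖(T ^ p) (ξ - φ)‖ ≤ (μ ^ p)⁻¹ * (ν ^ p * ‖ξ - φ‖) := by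
          gcongr; exact (key p).2
      _ = ‖ξ - φ‖ * (ν ^ p / μ ^ p) := by ring

end PowerIteration

/-! ### Density of test functions and the translation estimate in `H¹(ℝᵈ)` -/

section TestFunctions

variable {d : ℕ}

theorem IsTest.memLp {Ω : Set (Eu d)} {φ : Eu d → ℝ} (hφ : IsTest Ω φ) :
    MemLp φ 2 (vol Ω) :=
  hφ.1.continuous.memLp_of_hasCompactSupport hφ.2.1

/-- The classes of test functions in `L²(Ω)`. -/
def testSubmodule (Ω : Set (Eu d)) : Submodule ℝ (Lp ℝ 2 (vol Ω)) where
  carrier := {u | ∃ φ : Eu d → ℝ, IsTest Ω φ ∧ u =ᵐ[vol Ω] φ}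
  add_mem' := by
    rintro u v ⟨φ, hφ, hu⟩ ⟨ψ, hψ, hv⟩
    refine ⟨φ + ψ, ⟨hφ.1.add hψ.1, hφ.2.1.add hψ.2.1, ?_⟩, ?_⟩
    · exact (tsupport_add φ ψ).trans (Set.union_subset hφ.2.2 hψ.2.2)
    · exact (Lp.coeFn_add u v).trans (hu.add hv)
  zero_mem' := ⟨0, ⟨contDiff_const, HasCompactSupport.zero, by simp [tsupport_zero]⟩,
    Lp.coeFn_zero ℝ 2 (vol Ω)⟩
  smul_mem' := by
    rintro c u ⟨φ, hφ, hu⟩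
    refine ⟨c • φ, ⟨contDiff_const.smul hφ.1, hφ.2.1.smul_left, ?_⟩, ?_⟩
    · exact (tsupport_smul_subset_right (fun _ => c) φ).trans hφ.2.2
    · exact (Lp.coeFn_smul c u).trans (hu.const_smul c)

theorem L2_inner_eq_integral_mul {α : Type*} [MeasurableSpace α] {μ : Measure α}
    (u v : Lp ℝ 2 μ) : inner ℝ u v = ∫ x, u x * v x ∂μ := by
  rw [L2.inner_def]
  refine integral_congr_ae (ae_of_all _ fun x => ?_)
  simp [mul_comm]

/-- Fundamental lemma of the calculus of variations: a function orthogonal to every test function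
vanishes almost everywhere. -/
theorem topologicalClosure_testSubmodule {Ω : Set (Eu d)} (hΩ : IsOpen Ω) :
    (testSubmodule Ω).topologicalClosure = ⊤ := by
  rw [Submodule.topologicalClosure_eq_top_iff, Submodule.eq_bot_iff]
  intro u hu
  have hloc : LocallyIntegrableOn u Ω volume := by
    have h1 : LocallyIntegrable u (vol Ω) := (Lp.memLp u).locallyIntegrable (by norm_num)
    exact locallyIntegrableOn_of_locallyIntegrable_restrict h1
  have h := hΩ.ae_eq_zero_of_integral_contDiff_smul_eq_zero hloc (fun φ h1 h2 h3 => by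
    have hφ : IsTest Ω φ := ⟨h1, h2, h3⟩
    have h0 := hu (hφ.memLp.toLp φ) ⟨φ, hφ, hφ.memLp.coeFn_toLp⟩
    rw [L2_inner_eq_integral_mul] at h0
    rw [← setIntegral_eq_integral_of_forall_compl_eq_zero (s := Ω)]
    · rw [← h0]
      refine integral_congr_ae ?_
      filter_upwards [hφ.memLp.coeFn_toLp] with x hx
      rw [hx, smul_eq_mul]
    · intro x hx
      rw [image_eq_zero_of_notMem_tsupport fun hx' => hx (h3 hx'), zero_smul])
  refine (Lp.eq_zero_iff_ae_eq_zero).2 ?_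
  exact (ae_restrict_iff' hΩ.measurableSet).2 h

theorem abs_integral_mul_le {α : Type*} [MeasurableSpace α] {μ : Measure α} {f g : α → ℝ}
    (hf : MemLp f 2 μ) (hg : MemLp g 2 μ) :
    |∫ x, f x * g x ∂μ| ≤ (eLpNorm f 2 μ).toReal * (eLpNorm g 2 μ).toReal := by
  have h := abs_real_inner_le_norm (hf.toLp f) (hg.toLp g)
  rw [L2_inner_eq_integral_mul, Lp.norm_toLp, Lp.norm_toLp] at h
  refine le_of_eq_of_le (congrArg _ (integral_congr_ae ?_)) h
  filter_upwards [hf.coeFn_toLp, hg.coeFn_toLp] with x h1 h2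
  rw [h1, h2]

/-- The `L²` norm by duality: by density the bound extends from test functions to `f` itself, and
one factor of the norm of `f` is divided out. -/
theorem eLpNorm_le_of_forall_isTest {Ω : Set (Eu d)} (hΩ : IsOpen Ω) {f : Eu d → ℝ}
    (hf : MemLp f 2 (vol Ω)) {c : ℝ}
    (h : ∀ φ, IsTest Ω φ → |∫ x in Ω, f x * φ x| ≤ c * (eLpNorm φ 2 (vol Ω)).toReal) :
    eLpNorm f 2 (vol Ω) ≤ ENNReal.ofReal c := by
  let D := hf.toLp f
  have hcl : IsClosed {v : Lp ℝ 2 (vol Ω) | |inner ℝ D v| ≤ c * ‖v‖} :=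
    isClosed_le (by fun_prop) (by fun_prop)
  have hsub : (testSubmodule Ω : Set (Lp ℝ 2 (vol Ω))) ⊆ {v | |inner ℝ D v| ≤ c * ‖v‖} := by
    rintro v ⟨φ, hφ, hv⟩
    have h1 := h φ hφ
    rw [Set.mem_ofPred_eq, Lp.norm_def, eLpNorm_congr_ae hv, L2_inner_eq_integral_mul]
    refine le_of_eq_of_le (congrArg _ (integral_congr_ae ?_)) h1
    filter_upwards [hf.coeFn_toLp, hv] with x h2 h3
    rw [h2, h3]
  have hD : D ∈ (testSubmodule Ω).topologicalClosure := by
    rw [topologicalClosure_testSubmodule hΩ]; trivial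
  have h2 : |inner ℝ D D| ≤ c * ‖D‖ := closure_minimal hsub hcl hD
  rw [real_inner_self_eq_norm_sq, abs_of_nonneg (sq_nonneg _), sq] at h2
  have h3 : ‖D‖ ≤ c ∨ ‖D‖ = 0 := by
    rcases (norm_nonneg D).eq_or_lt with h0 | h0
    · exact Or.inr h0.symm
    · exact Or.inl (le_of_mul_le_mul_right h2 h0)
  rw [Lp.norm_toLp] at h3
  rcases h3 with h3 | h3
  · rw [← ENNReal.ofReal_toReal hf.2.ne]
    exact ENNReal.ofReal_le_ofReal h3
  · rw [(ENNReal.toReal_eq_zero_iff _).1 h3 |>.resolve_right hf.2.ne]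
    exact zero_le

/-- Difference quotients of a function with a square integrable weak gradient. -/
theorem eLpNorm_translate_sub_le {U : Eu d → ℝ} {g : Eu d → Eu d}
    (hU : MemLp U 2 volume) (hg : MemLp g 2 volume)
    (hw : ∀ φ : Eu d → ℝ, IsTest Set.univ φ → ∀ e : Eu d,
      ∫ x, U x * fderiv ℝ φ x e = - ∫ x, inner ℝ (g x) e * φ x) (h : Eu d) :
    eLpNorm (fun x => U (x + h) - U x) 2 volume
      ≤ ENNReal.ofReal (‖h‖ * (eLpNorm g 2 volume).toReal) := by
  set N := (eLpNorm g 2 volume).toReal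
  have hUh : MemLp (fun x => U (x + h)) 2 volume :=
    hU.comp_measurePreserving (measurePreserving_add_right volume h)
  have hdiff : MemLp (fun x => U (x + h) - U x) 2 volume := hUh.sub hU
  have hge : ∀ e : Eu d, MemLp (fun x => inner ℝ (g x) e) 2 volume ∧
      (eLpNorm (fun x => inner ℝ (g x) e) 2 volume).toReal ≤ ‖e‖ * N := by
    intro e
    have hb : ∀ᵐ x ∂(volume : Measure (Eu d)), ‖(inner ℝ (g x) e : ℝ)‖ ≤ ‖e‖ * ‖g x‖ :=
      ae_of_all _ fun x => (norm_inner_le_norm (g x) e).trans_eq (mul_comm _ _)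
    have hm : AEStronglyMeasurable (fun x => (inner ℝ (g x) e : ℝ)) volume :=
      hg.1.inner_const
    refine ⟨hg.of_le_mul hm hb, ?_⟩
    have h1 := eLpNorm_le_mul_eLpNorm_of_ae_le_mul hb 2
    have h2 := ENNReal.toReal_mono (ENNReal.mul_ne_top ENNReal.ofReal_ne_top hg.2.ne) h1
    rwa [ENNReal.toReal_mul, ENNReal.toReal_ofReal (norm_nonneg e)] at h2
  have key := eLpNorm_le_of_forall_isTest (Ω := (Set.univ : Set (Eu d))) isOpen_univ
    (f := fun x => U (x + h) - U x) (c := ‖h‖ * N) (by simpa [vol] using hdiff)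
  simp only [vol, Measure.restrict_univ] at key
  refine key fun φ hφ => ?_
  have hφL : MemLp φ 2 volume := by simpa [vol] using hφ.memLp
  let P := (eLpNorm φ 2 volume).toReal
  -- Reflecting `φ` turns the convolution into `z ↦ ∫ U(x) φ(x - z) dx`, the pairing of `φ` with the
  -- translate `U(· + z)`. This is differentiable in `z` because the derivative falls on `φ`; the
  -- weak gradient moves it back to `U`.
  let φ' : Eu d → ℝ := fun y => φ (-y)
  have hφ'1 : ContDiff ℝ 1 φ' := (hφ.1.comp contDiff_neg).of_le (by norm_cast)
  have hφ'c : HasCompactSupport φ' := hφ.2.1.comp_homeomorph (Homeomorph.neg _)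
  let L := ContinuousLinearMap.mul ℝ ℝ
  have hUl : LocallyIntegrable U volume := hU.locallyIntegrable (by norm_num)
  let F : Eu d → ℝ := convolution U φ' L volume
  have hF : ∀ z, F z = ∫ x, U x * φ (x - z) := by
    intro z
    simp only [F, convolution_def, φ', L]
    simp
  have hder : ∀ z, HasFDerivAt F _ z := fun z =>
    hφ'c.hasFDerivAt_convolution_right L hUl hφ'1 z
  have hbound : ∀ z, ‖convolution U (fderiv ℝ φ') (L.precompR (Eu d)) volume z‖ ≤ N * P := by
    intro z
    refine ContinuousLinearMap.opNorm_le_bound _ (by positivity) fun e => ?_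
    rw [convolution_precompR_apply L hUl (hφ'c.fderiv ℝ) (hφ'1.continuous_fderiv one_ne_zero)]
    let ψ : Eu d → ℝ := fun x => φ (x - z)
    have hψ : IsTest Set.univ ψ :=
      ⟨hφ.1.comp (contDiff_id.sub contDiff_const),
        hφ.2.1.comp_homeomorph (Homeomorph.subRight z), Set.subset_univ _⟩
    have hψL : MemLp ψ 2 volume := by simpa [vol] using hψ.memLp
    have hψP : (eLpNorm ψ 2 volume).toReal = P := by
      congr 1
      exact eLpNorm_comp_measurePreserving hφL.1 (measurePreserving_sub_right volume z)
    have hφd : Differentiable ℝ φ := hφ.1.differentiable (by simp)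
    have h1 : ∀ t, fderiv ℝ φ' (z - t) e = - fderiv ℝ ψ t e := by
      intro t
      have h2 : HasFDerivAt φ' ((fderiv ℝ φ (-(z - t))).comp (-ContinuousLinearMap.id ℝ (Eu d)))
          (z - t) :=
        (hφd (-(z - t))).hasFDerivAt.comp (z - t) (hasFDerivAt_id _).neg
      have h3 : HasFDerivAt ψ ((fderiv ℝ φ (t - z)).comp (ContinuousLinearMap.id ℝ (Eu d))) t :=
        (hφd (t - z)).hasFDerivAt.comp t ((hasFDerivAt_id _).sub_const z)
      rw [h2.fderiv, h3.fderiv, neg_sub]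
      simp
    have h4 : (convolution U (fun a => fderiv ℝ φ' a e) L volume) z
        = ∫ x, inner ℝ (g x) e * ψ x := by
      rw [convolution_def]
      simp only [L, ContinuousLinearMap.mul_apply', h1, mul_neg]
      rw [integral_neg, hw ψ hψ e, neg_neg]
    rw [h4, Real.norm_eq_abs]
    refine (abs_integral_mul_le (hge e).1 hψL).trans ?_
    rw [hψP]
    calc _ ≤ ‖e‖ * N * P := by gcongr; exact (hge e).2
      _ = N * P * ‖e‖ := by ring
  -- Mean value inequality along the translation, with the gradient bound uniform in `z`.
  have hmv : ‖F h - F 0‖ ≤ N * P * ‖h - 0‖ :=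
    convex_univ.norm_image_sub_le_of_norm_hasFDerivWithin_le
      (fun z _ => (hder z).hasFDerivWithinAt) (fun z _ => hbound z) (Set.mem_univ _)
      (Set.mem_univ _)
  have hinteg : ∀ {f : Eu d → ℝ}, MemLp f 2 volume → Integrable (fun x => f x * φ x) volume :=
    fun hf => hf.integrable_mul hφL
  have heq : ∫ x, (U (x + h) - U x) * φ x = F h - F 0 := by
    simp only [sub_mul]
    rw [integral_sub (hinteg hUh) (hinteg hU), hF, hF,
      ← integral_add_right_eq_self (fun x => U x * φ (x - h)) h]
    simp
  rw [heq, ← Real.norm_eq_abs]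
  refine hmv.trans_eq ?_
  rw [sub_zero]
  simp only [P]
  ring

end TestFunctions

/-! ### Rellich's theorem by averaging over a grid -/

section Rellich

variable {d : ℕ}

/-- The half-open cube of side `ε` with index `k` in the grid of `ℝᵈ`. -/
def gridCube (ε : ℝ) (k : Fin d → ℤ) : Set (Eu d) := {x | ∀ i, ⌊x i / ε⌋ = k i}

theorem gridCube_eq_preimage {ε : ℝ} (hε : 0 < ε) (k : Fin d → ℤ) :
    gridCube ε k = (@WithLp.ofLp 2 (Fin d → ℝ)) ⁻¹'
      (Set.univ.pi fun i => Set.Ico (k i * ε) ((k i + 1) * ε)) := by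
  ext x
  simp only [gridCube, Set.mem_ofPred_eq, Set.mem_preimage, Set.mem_univ_pi, Set.mem_Ico,
    Int.floor_eq_iff, le_div_iff₀ hε, div_lt_iff₀ hε]

theorem measurableSet_gridCube {ε : ℝ} (hε : 0 < ε) (k : Fin d → ℤ) :
    MeasurableSet (gridCube ε k) := by
  rw [gridCube_eq_preimage hε]
  exact (PiLp.volume_preserving_ofLp (Fin d)).measurable
    (MeasurableSet.univ_pi fun _ => measurableSet_Ico)

theorem volume_gridCube {ε : ℝ} (hε : 0 < ε) (k : Fin d → ℤ) :
    volume (gridCube ε k) = ENNReal.ofReal ε ^ d := by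
  rw [gridCube_eq_preimage hε, (PiLp.volume_preserving_ofLp (Fin d)).measure_preimage
    (MeasurableSet.univ_pi fun _ => measurableSet_Ico).nullMeasurableSet, Real.volume_pi_Ico]
  have : ∀ i, ((k i : ℝ) + 1) * ε - k i * ε = ε := fun i => by ring
  simp [this]

theorem pairwise_disjoint_gridCube (ε : ℝ) :
    Pairwise fun k l : Fin d → ℤ => Disjoint (gridCube ε k) (gridCube ε l) := by
  intro k l hkl
  rw [Set.disjoint_left]
  intro x hx hy
  exact hkl (funext fun i => (hx i).symm.trans (hy i))

theorem norm_sub_le_of_mem_gridCube {ε : ℝ} (hε : 0 < ε) {k : Fin d → ℤ} {x y : Eu d}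
    (hx : x ∈ gridCube ε k) (hy : y ∈ gridCube ε k) : ‖y - x‖ ≤ √d * ε := by
  rw [gridCube_eq_preimage hε] at hx hy
  rw [EuclideanSpace.norm_eq]
  have h : ∑ i, ‖(y - x) i‖ ^ 2 ≤ d * ε ^ 2 := by
    refine (Finset.sum_le_card_nsmul Finset.univ _ (ε ^ 2) fun i _ => ?_).trans_eq (by simp)
    have h1 := hx i trivial
    have h2 := hy i trivial
    simp only [Set.mem_Ico] at h1 h2
    have h3 : |y i - x i| ≤ ε := by
      rw [abs_le]; constructor <;> nlinarith
    simpa using (sq_le_sq₀ (abs_nonneg _) hε.le).2 h3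
  calc √(∑ i, ‖(y - x) i‖ ^ 2) ≤ √(d * ε ^ 2) := Real.sqrt_le_sqrt h
    _ = √d * ε := by rw [Real.sqrt_mul (by positivity), Real.sqrt_sq hε.le]

theorem exists_finset_subset_iUnion_gridCube {Ω : Set (Eu d)} (hΩ : Bornology.IsBounded Ω)
    {ε : ℝ} (hε : 0 < ε) : ∃ s : Finset (Fin d → ℤ), Ω ⊆ ⋃ k ∈ s, gridCube ε k := by
  obtain ⟨R, hR⟩ := hΩ.subset_closedBall 0
  refine ⟨Fintype.piFinset fun _ => Finset.Icc ⌊-R / ε⌋ ⌊R / ε⌋, fun x hx => ?_⟩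
  have hx' : ‖x‖ ≤ R := by simpa using hR hx
  simp only [Set.mem_iUnion]
  refine ⟨fun i => ⌊x i / ε⌋, ?_, fun i => rfl⟩
  rw [Fintype.mem_piFinset]
  intro i
  have h1 : |x i| ≤ R := (PiLp.norm_apply_le x i).trans hx'
  rw [abs_le] at h1
  rw [Finset.mem_Icc]
  exact ⟨Int.floor_le_floor (div_le_div_of_nonneg_right h1.1 hε.le),
    Int.floor_le_floor (div_le_div_of_nonneg_right h1.2 hε.le)⟩

theorem eLpNorm_two_sq {α E : Type*} [MeasurableSpace α] [NormedAddCommGroup E] (μ : Measure α)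
    (f : α → E) : eLpNorm f 2 μ ^ 2 = ∫⁻ x, ‖f x‖ₑ ^ 2 ∂μ := by
  rw [eLpNorm_eq_lintegral_rpow_enorm_toReal (by norm_num) (by norm_num),
    ← ENNReal.rpow_natCast, ← ENNReal.rpow_mul]
  norm_num

/-- Cauchy-Schwarz against the constant function `1`. -/
theorem enorm_integral_sq_le {α : Type*} [MeasurableSpace α] {μ : Measure α} {f : α → ℝ}
    (hf : AEStronglyMeasurable f μ) :
    ‖∫ x, f x ∂μ‖ₑ ^ 2 ≤ μ Set.univ * ∫⁻ x, ‖f x‖ₑ ^ 2 ∂μ := by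
  have h1 := ENNReal.lintegral_mul_le_Lp_mul_Lq μ (p := 2) (q := 2)
    (Real.HolderConjugate.two_two) (f := fun _ => 1) (g := fun x => ‖f x‖ₑ)
    aemeasurable_const hf.enorm
  have h2 : ‖∫ x, f x ∂μ‖ₑ ≤ ∫⁻ x, ‖f x‖ₑ ∂μ := enorm_integral_le_lintegral_enorm f
  simp only [Pi.mul_apply, one_mul, lintegral_const, ENNReal.rpow_ofNat] at h1
  have h3 : ∀ a : ENNReal, (a ^ (1 / (2 : ℝ))) ^ 2 = a := fun a => by
    rw [← ENNReal.rpow_natCast, ← ENNReal.rpow_mul]; norm_num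
  calc _ ≤ (∫⁻ x, ‖f x‖ₑ ∂μ) ^ 2 := by gcongr
    _ ≤ _ := pow_le_pow_left' h1 2
    _ = _ := by rw [mul_pow, h3, h3, one_pow, one_mul]

/-- Poincaré-Wirtinger inequality in terms of differences. -/
theorem measure_mul_lintegral_sub_average_le {α : Type*} [MeasurableSpace α] {μ : Measure α}
    [IsFiniteMeasure μ] (hμ : μ ≠ 0) {f : α → ℝ} (hf : Integrable f μ) :
    μ Set.univ * ∫⁻ x, ‖f x - ⨍ y, f y ∂μ‖ₑ ^ 2 ∂μ
      ≤ ∫⁻ x, ∫⁻ y, ‖f x - f y‖ₑ ^ 2 ∂μ ∂μ := by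
  have hne : μ Set.univ ≠ 0 := by simpa using hμ
  have hr : μ.real Set.univ ≠ 0 := by simpa [measureReal_def, ENNReal.toReal_eq_zero_iff] using hμ
  rw [← lintegral_const_mul' _ _ (measure_ne_top _ _)]
  refine lintegral_mono fun x => ?_
  -- The deviation from the average is the average over `y` of `f x - f y`, to which Cauchy-Schwarz
  -- applies for fixed `x`.
  have hx : ∫ y, (f x - f y) ∂μ = μ.real Set.univ * (f x - ⨍ y, f y ∂μ) := by
    rw [integral_sub (integrable_const _) hf, integral_const, average_eq, smul_eq_mul, smul_eq_mul]
    field_simp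
  have h1 := enorm_integral_sq_le (μ := μ) (f := fun y => f x - f y)
    (aestronglyMeasurable_const.sub hf.1)
  rw [hx, enorm_mul, mul_pow] at h1
  have h2 : ‖μ.real Set.univ‖ₑ = μ Set.univ := by
    rw [measureReal_def, Real.enorm_of_nonneg ENNReal.toReal_nonneg,
      ENNReal.ofReal_toReal (measure_ne_top _ _)]
  rw [h2, sq (μ Set.univ), mul_assoc] at h1
  exact (ENNReal.mul_le_mul_iff_right hne (measure_ne_top _ _)).1 h1

/-- Two points of one cube differ by some `h` with `‖h‖ ≤ √d ε`. Substituting `y = x + h`, using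
that the cubes are disjoint and exchanging the integrals leaves, for each such `h`, a difference
quotient on the whole space. The bound therefore does not depend on the number of cubes. -/
theorem sum_lintegral_gridCube_le {U : Eu d → ℝ} (hUm : Measurable U) {N : ℝ}
    (hN : ∀ h : Eu d, eLpNorm (fun x => U (x + h) - U x) 2 volume ≤ ENNReal.ofReal (‖h‖ * N))
    (hN0 : 0 ≤ N) {ε : ℝ} (hε : 0 < ε) (s : Finset (Fin d → ℤ)) :
    ∑ k ∈ s, ∫⁻ x in gridCube ε k, ∫⁻ y in gridCube ε k, ‖U x - U y‖ₑ ^ 2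
      ≤ ENNReal.ofReal (√d * ε * N) ^ 2 * volume (Metric.closedBall (0 : Eu d) (√d * ε)) := by
  set B := Metric.closedBall (0 : Eu d) (√d * ε) with hB
  have h1 : ∀ k, ∀ x ∈ gridCube ε k, ∫⁻ y in gridCube ε k, ‖U x - U y‖ₑ ^ 2
      ≤ ∫⁻ h in B, ‖U (x + h) - U x‖ₑ ^ 2 := by
    intro k x hx
    rw [← lintegral_indicator (measurableSet_gridCube hε k),
      ← lintegral_indicator Metric.isClosed_closedBall.measurableSet,
      ← lintegral_add_left_eq_self _ x]
    refine lintegral_mono fun h => ?_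
    by_cases hh : x + h ∈ gridCube ε k
    · have hhB : h ∈ B := by
        have := norm_sub_le_of_mem_gridCube hε hx hh
        simpa [hB] using this
      rw [Set.indicator_of_mem hh, Set.indicator_of_mem hhB, ← enorm_neg, neg_sub]
    · rw [Set.indicator_of_notMem hh]
      exact zero_le
  calc _ ≤ ∑ k ∈ s, ∫⁻ x in gridCube ε k, ∫⁻ h in B, ‖U (x + h) - U x‖ₑ ^ 2 :=
        Finset.sum_le_sum fun k _ => setLIntegral_mono' (measurableSet_gridCube hε k) (h1 k)
    _ = ∫⁻ x in ⋃ k ∈ s, gridCube ε k, ∫⁻ h in B, ‖U (x + h) - U x‖ₑ ^ 2 :=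
        (lintegral_biUnion_finset (fun k _ l _ hkl => pairwise_disjoint_gridCube ε hkl)
          (fun k _ => measurableSet_gridCube hε k) _).symm
    _ ≤ ∫⁻ x, ∫⁻ h in B, ‖U (x + h) - U x‖ₑ ^ 2 := setLIntegral_le_lintegral _ _
    _ = ∫⁻ h in B, ∫⁻ x, ‖U (x + h) - U x‖ₑ ^ 2 := by
        refine lintegral_lintegral_swap (Measurable.aemeasurable ?_)
        simp only [Function.uncurry_def]
        fun_prop
    _ ≤ ∫⁻ _ in B, ENNReal.ofReal (√d * ε * N) ^ 2 := by
        refine setLIntegral_mono' Metric.isClosed_closedBall.measurableSet fun h hh => ?_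
        rw [← eLpNorm_two_sq]
        refine pow_le_pow_left' ((hN h).trans (ENNReal.ofReal_le_ofReal ?_)) 2
        have : ‖h‖ ≤ √d * ε := by simpa [hB] using hh
        gcongr
    _ = _ := by rw [setLIntegral_const]

/-- Approximation by averages over the cubes of a grid. -/
theorem sum_lintegral_sub_average_le {U : Eu d → ℝ} (hUm : Measurable U)
    (hU : MemLp U 2 volume) {N : ℝ}
    (hN : ∀ h : Eu d, eLpNorm (fun x => U (x + h) - U x) 2 volume ≤ ENNReal.ofReal (‖h‖ * N))
    (hN0 : 0 ≤ N) {ε : ℝ} (hε : 0 < ε) (s : Finset (Fin d → ℤ)) :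
    ∑ k ∈ s, ∫⁻ x in gridCube ε k, ‖U x - ⨍ y in gridCube ε k, U y‖ₑ ^ 2
      ≤ ENNReal.ofReal (√d * ε * N) ^ 2 *
        (ENNReal.ofReal (√d) ^ d * volume (Metric.ball (0 : Eu d) 1)) := by
  have hpos : ENNReal.ofReal ε ^ d ≠ 0 := pow_ne_zero _ (by simpa using hε)
  have htop : ENNReal.ofReal ε ^ d ≠ ⊤ := ENNReal.pow_ne_top ENNReal.ofReal_ne_top
  -- The volume `ε ^ d` of a cube, needed for the Poincaré-Wirtinger inequality, cancels the `ε ^ d`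
  -- in the volume of the ball of differences, so that a factor `ε²` survives.
  rw [← ENNReal.mul_le_mul_iff_right hpos htop, Finset.mul_sum]
  have hball : volume (Metric.closedBall (0 : Eu d) (√d * ε))
      = ENNReal.ofReal ε ^ d * (ENNReal.ofReal (√d) ^ d * volume (Metric.ball (0 : Eu d) 1)) := by
    rw [Measure.addHaar_closedBall _ _ (by positivity), finrank_euclideanSpace_fin,
      ENNReal.ofReal_pow (by positivity), ENNReal.ofReal_mul (by positivity), mul_pow]
    ring
  calc _ ≤ ∑ k ∈ s, ∫⁻ x in gridCube ε k, ∫⁻ y in gridCube ε k, ‖U x - U y‖ₑ ^ 2 := by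
        refine Finset.sum_le_sum fun k _ => ?_
        have hvol := volume_gridCube hε k
        have : IsFiniteMeasure (volume.restrict (gridCube ε k)) :=
          ⟨by rw [Measure.restrict_apply_univ, hvol]; exact htop.lt_top⟩
        have h := measure_mul_lintegral_sub_average_le (μ := volume.restrict (gridCube ε k))
          (by rw [Ne, Measure.restrict_eq_zero, hvol]; exact hpos)
          ((hU.restrict _).integrable (by norm_num))
        rwa [Measure.restrict_apply_univ, hvol] at h
    _ ≤ _ := sum_lintegral_gridCube_le hUm hN hN0 hε s
    _ = _ := by rw [hball]; ring

/-- The compact set may depend on `δ`: a finite `δ/2`-net of a compact set that is `δ/2`-close to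
`S` is a `δ`-net of `S`. -/
theorem totallyBounded_of_forall_approx {α : Type*} [PseudoMetricSpace α] {S : Set α}
    (h : ∀ δ > 0, ∃ K : Set α, IsCompact K ∧ ∀ u ∈ S, ∃ v ∈ K, dist u v ≤ δ) :
    TotallyBounded S := by
  rw [Metric.totallyBounded_iff]
  intro δ hδ
  obtain ⟨K, hK, hS⟩ := h (δ / 2) (by positivity)
  obtain ⟨t, ht, hcov⟩ := Metric.totallyBounded_iff.1 hK.totallyBounded (δ / 2) (by positivity)
  refine ⟨t, ht, fun u hu => ?_⟩
  obtain ⟨v, hv, huv⟩ := hS u hu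
  obtain ⟨y, hy, hvy⟩ := Set.mem_iUnion₂.1 (hcov hv)
  refine Set.mem_iUnion₂.2 ⟨y, hy, ?_⟩
  rw [Metric.mem_ball] at hvy ⊢
  linarith [dist_triangle u v y]

/-- Rellich's theorem: on a bounded region, the restrictions of a bounded subset of `H¹(ℝᵈ)` form
a totally bounded subset of `L²`. -/
theorem totallyBounded_of_extension {Ω : Set (Eu d)} (hbdd : Bornology.IsBounded Ω)
    {S : Set (Lp ℝ 2 (vol Ω))} {C : ℝ}
    (hS : ∀ u ∈ S, ∃ W ∈ sobolevH1 (Set.univ : Set (Eu d)),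
      (W.fst : Eu d → ℝ) =ᵐ[vol Ω] u ∧ ‖W‖ ≤ C) :
    TotallyBounded S := by
  refine totallyBounded_of_forall_approx fun δ hδ => ?_
  set D := ENNReal.ofReal (√d) ^ d * volume (Metric.ball (0 : Eu d) 1)
  have hDtop : D ≠ ⊤ := ENNReal.mul_ne_top (ENNReal.pow_ne_top ENNReal.ofReal_ne_top)
    measure_ball_lt_top.ne
  -- The bound `C` may be negative (if `S` is empty), while the estimates need a nonnegative
  -- constant.
  set C' := max C 0
  obtain ⟨ε, hε, hεδ⟩ : ∃ ε : ℝ, 0 < ε ∧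
      ENNReal.ofReal (√d * ε * C') ^ 2 * D ≤ ENNReal.ofReal δ ^ 2 := by
    have hlim : Tendsto (fun ε : ℝ => ENNReal.ofReal (√d * ε * C') ^ 2 * D) (𝓝[>] 0) (𝓝 0) := by
      have h1 : Tendsto (fun ε : ℝ => √d * ε * C') (𝓝[>] 0) (𝓝 (√d * 0 * C')) :=
        tendsto_nhdsWithin_of_tendsto_nhds (Continuous.tendsto (by fun_prop) 0)
      have h2 := ENNReal.Tendsto.mul_const (ENNReal.Tendsto.pow (n := 2)
        (ENNReal.tendsto_ofReal h1)) (Or.inr hDtop : _ ∨ D ≠ ⊤)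
      simpa using h2
    have hδ' : (0 : ENNReal) < ENNReal.ofReal δ ^ 2 :=
      ENNReal.pow_pos (ENNReal.ofReal_pos.2 hδ) 2
    obtain ⟨ε, h1, h2⟩ := ((hlim.eventually (ge_mem_nhds hδ')).and
      self_mem_nhdsWithin).exists
    exact ⟨ε, h2, h1⟩
  obtain ⟨s, hs⟩ := exists_finset_subset_iUnion_gridCube hbdd hε
  have hQm := fun k : Fin d → ℤ => measurableSet_gridCube hε k
  have hQv := fun k : Fin d → ℤ => volume_gridCube hε k
  have hQtop : ENNReal.ofReal ε ^ d ≠ ⊤ := ENNReal.pow_ne_top ENNReal.ofReal_ne_top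
  have hQtop' : ∀ k : Fin d → ℤ, vol Ω (gridCube ε k) ≠ ⊤ := fun k =>
    ((Measure.restrict_apply_le _ _).trans_lt (by rw [hQv k]; exact hQtop.lt_top)).ne
  -- Functions constant on each of the finitely many cubes meeting the cover depend continuously on
  -- their values. With values bounded by `R`, they form the approximating compact set.
  let step : ((Fin d → ℤ) → ℝ) → Lp ℝ 2 (vol Ω) := fun c =>
    ∑ k ∈ s, c k • indicatorConstLp 2 (hQm k) (hQtop' k) (1 : ℝ)
  have hstep : Continuous step := by
    refine continuous_finsetSum _ fun k _ => ?_
    exact (continuous_apply k).smul continuous_const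
  -- Cauchy-Schwarz on one cube bounds the averages by a constant that depends only on `ε`, `d` and
  -- `C'`.
  obtain ⟨R, hR⟩ : ∃ R : ℝ, ∀ U : Eu d → ℝ, MemLp U 2 volume →
      (eLpNorm U 2 volume).toReal ≤ C' → ∀ k, |⨍ y in gridCube ε k, U y| ≤ R := by
    refine ⟨(ε ^ d)⁻¹ * (√(ε ^ d) * C'), fun U hU hUC k => ?_⟩
    have hreal : volume.real (gridCube ε k) = ε ^ d := by
      rw [measureReal_def, hQv k, ENNReal.toReal_pow, ENNReal.toReal_ofReal hε.le]
    rw [setAverage_eq, hreal, smul_eq_mul, abs_mul, abs_of_nonneg (by positivity)]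
    refine mul_le_mul_of_nonneg_left ?_ (by positivity)
    have hone : MemLp ((gridCube ε k).indicator fun _ => (1 : ℝ)) 2 volume :=
      memLp_indicator_const 2 (hQm k) 1 (Or.inr (by rw [hQv k]; exact hQtop))
    have h1 := abs_integral_mul_le hone hU
    have h2 : ∫ x, (gridCube ε k).indicator (fun _ => (1 : ℝ)) x * U x
        = ∫ x in gridCube ε k, U x := by
      rw [← integral_indicator (hQm k)]
      refine integral_congr_ae (ae_of_all _ fun x => ?_)
      by_cases hx : x ∈ gridCube ε k <;> simp [hx]
    rw [h2] at h1
    refine h1.trans ?_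
    have h3 : (eLpNorm ((gridCube ε k).indicator fun _ => (1 : ℝ)) 2 volume).toReal
        = √(ε ^ d) := by
      rw [eLpNorm_indicator_const (hQm k) (by norm_num) (by norm_num), hQv k,
        enorm_one, one_mul, ← ENNReal.toReal_rpow, ENNReal.toReal_pow,
        ENNReal.toReal_ofReal hε.le, Real.sqrt_eq_rpow]
      norm_num
    rw [h3]
    gcongr
  refine ⟨step '' (Set.univ.pi fun _ => Set.Icc (-R) R),
    (isCompact_univ_pi fun _ => isCompact_Icc).image hstep, fun u hu => ?_⟩
  obtain ⟨W, hW, hWu, hWC⟩ := hS u hu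
  have hmeas : vol (Set.univ : Set (Eu d)) = volume := Measure.restrict_univ
  have hnorm : ∀ {E : Type} [NormedAddCommGroup E] (f : Eu d → E),
      eLpNorm f 2 (vol Set.univ) = eLpNorm f 2 volume := fun f => by rw [hmeas]
  have hfst : MemLp W.fst 2 volume := hmeas ▸ Lp.memLp W.fst
  have hsnd : MemLp W.snd 2 volume := hmeas ▸ Lp.memLp W.snd
  have hfstC : (eLpNorm W.fst 2 volume).toReal ≤ C' := by
    have h1 : ‖W.fst‖ ≤ C' := (WithLp.norm_fst_le (x := W)).trans (hWC.trans (le_max_left _ _))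
    rwa [Lp.norm_def, hnorm] at h1
  have hsndC : (eLpNorm W.snd 2 volume).toReal ≤ C' := by
    have h1 : ‖W.snd‖ ≤ C' := (WithLp.norm_snd_le (x := W)).trans (hWC.trans (le_max_left _ _))
    rwa [Lp.norm_def, hnorm] at h1
  -- An honestly measurable representative, as required for exchanging the integrals over `x` and
  -- `h`.
  obtain ⟨U, hUm, hWU⟩ : ∃ U : Eu d → ℝ, Measurable U ∧ W.fst =ᵐ[volume] U :=
    ⟨hfst.1.mk, hfst.1.stronglyMeasurable_mk.measurable, hfst.1.ae_eq_mk⟩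
  have hU : MemLp U 2 volume := (memLp_congr_ae hWU).1 hfst
  have hUC : (eLpNorm U 2 volume).toReal ≤ C' := by rwa [← eLpNorm_congr_ae hWU]
  have hN : ∀ h : Eu d, eLpNorm (fun x => U (x + h) - U x) 2 volume
      ≤ ENNReal.ofReal (‖h‖ * C') := by
    intro h
    refine (eLpNorm_translate_sub_le hU hsnd (fun φ hφ e => ?_) h).trans
      (ENNReal.ofReal_le_ofReal (by gcongr))
    have := hW φ hφ e
    rw [Measure.restrict_univ] at this
    rw [← this]
    refine integral_congr_ae ?_
    filter_upwards [hWU] with x hx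
    rw [hx]
  let c : (Fin d → ℤ) → ℝ := fun k => ⨍ y in gridCube ε k, U y
  refine ⟨step c, ⟨c, fun k _ => ?_, rfl⟩, ?_⟩
  · exact abs_le.1 (hR U hU hUC k)
  have huU : u =ᵐ[vol Ω] U := hWu.symm.trans (ae_restrict_of_ae hWU)
  have hstepc : step c =ᵐ[vol Ω] fun x => ∑ k ∈ s, (gridCube ε k).indicator (fun _ => c k) x := by
    have h1 : ∀ k, (c k • indicatorConstLp 2 (hQm k) (hQtop' k) (1 : ℝ) : Lp ℝ 2 (vol Ω))
        =ᵐ[vol Ω] (gridCube ε k).indicator (fun _ => c k) := by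
      intro k
      filter_upwards [Lp.coeFn_smul (c k) (indicatorConstLp 2 (hQm k) (hQtop' k) (1 : ℝ)),
        indicatorConstLp_coeFn (p := 2) (hs := hQm k) (hμs := hQtop' k) (c := (1 : ℝ))]
        with x h2 h3
      rw [h2, Pi.smul_apply, h3]
      by_cases hx : x ∈ gridCube ε k <;> simp [hx]
    filter_upwards [Lp.coeFn_fun_finsetSum s
      (fun k => c k • indicatorConstLp 2 (hQm k) (hQtop' k) (1 : ℝ)),
      (Finset.eventually_all s).2 fun k _ => h1 k] with x h2 h3
    rw [h2]
    exact Finset.sum_congr rfl fun k hk => h3 k hk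
  rw [dist_eq_norm, Lp.norm_def]
  refine ENNReal.toReal_le_of_le_ofReal hδ.le ?_
  rw [← ENNReal.pow_le_pow_left_iff two_ne_zero]
  calc eLpNorm (u - step c : Lp ℝ 2 (vol Ω)) 2 (vol Ω) ^ 2
      = ∫⁻ x in Ω, ‖U x - ∑ k ∈ s, (gridCube ε k).indicator (fun _ => c k) x‖ₑ ^ 2 := by
        rw [eLpNorm_two_sq]
        refine lintegral_congr_ae ?_
        filter_upwards [Lp.coeFn_sub u (step c), huU, hstepc] with x h1 h2 h3
        rw [h1, Pi.sub_apply, h2, h3]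
    _ ≤ ∫⁻ x in ⋃ k ∈ s, gridCube ε k,
          ‖U x - ∑ k ∈ s, (gridCube ε k).indicator (fun _ => c k) x‖ₑ ^ 2 :=
        lintegral_mono_set hs
    _ = ∑ k ∈ s, ∫⁻ x in gridCube ε k,
          ‖U x - ∑ k ∈ s, (gridCube ε k).indicator (fun _ => c k) x‖ₑ ^ 2 :=
        lintegral_biUnion_finset (fun k _ l _ hkl => pairwise_disjoint_gridCube ε hkl)
          (fun k _ => hQm k) _
    _ = ∑ k ∈ s, ∫⁻ x in gridCube ε k, ‖U x - c k‖ₑ ^ 2 := by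
        refine Finset.sum_congr rfl fun k hk => setLIntegral_congr_fun (hQm k) fun x hx => ?_
        rw [Finset.sum_eq_single_of_mem k hk, Set.indicator_of_mem hx]
        intro l _ hlk
        exact Set.indicator_of_notMem
          (Set.disjoint_left.1 (pairwise_disjoint_gridCube ε hlk.symm) hx) _
    _ ≤ _ := sum_lintegral_sub_average_le hUm hU hN (le_max_right _ _) hε s
    _ ≤ _ := hεδ

end Rellich

/-! ### Poincaré's inequality and the Poisson problem -/

section Poisson

variable {d : ℕ} {Ω : Set (Eu d)} {V : Submodule ℝ (GradPair Ω)}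

/-- The embedding of the form domain in `L²(Ω)`. -/
noncomputable def formValue (V : Submodule ℝ (GradPair Ω)) : V →L[ℝ] Lp ℝ 2 (vol Ω) :=
  (WithLp.fstL 2 ℝ (Lp ℝ 2 (vol Ω)) (Lp (Eu d) 2 (vol Ω))).comp V.subtypeL

/-- The gradient on the form domain. -/
noncomputable def formGrad (V : Submodule ℝ (GradPair Ω)) : V →L[ℝ] Lp (Eu d) 2 (vol Ω) :=
  (WithLp.sndL 2 ℝ (Lp ℝ 2 (vol Ω)) (Lp (Eu d) 2 (vol Ω))).comp V.subtypeL

/-- The extension bound sends the unit ball of `V` to a bounded subset of `H¹(ℝᵈ)`, where Rellich's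
theorem applies. -/
theorem isCompactOperator_formValue (hbdd : Bornology.IsBounded Ω) (hext : HasExtension Ω V) :
    IsCompactOperator (formValue V) := by
  obtain ⟨C, hC⟩ := hext
  have hS : TotallyBounded (formValue V '' Metric.closedBall 0 1) := by
    refine totallyBounded_of_extension hbdd (C := |C|) ?_
    rintro _ ⟨w, hw, rfl⟩
    obtain ⟨W, hW, h1, h2⟩ := hC w.1 w.2
    refine ⟨W, hW, h1, h2.trans ?_⟩
    have hw1 : ‖w.1‖ ≤ 1 := by simpa using hw
    calc C * ‖w.1‖ ≤ |C| * ‖w.1‖ := by gcongr; exact le_abs_self C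
      _ ≤ |C| * 1 := by gcongr
      _ = |C| := mul_one _
  have hK : IsCompact (closure (formValue V '' Metric.closedBall 0 1)) :=
    isCompact_iff_totallyBounded_isComplete.2 ⟨hS.closure, isClosed_closure.isComplete⟩
  exact ⟨_, hK, Filter.mem_of_superset (Metric.closedBall_mem_nhds 0 one_pos)
    fun w hw => subset_closure ⟨w, hw, rfl⟩⟩

theorem gradPair_eq_zero_of_fst_snd {w : GradPair Ω} (h1 : w.fst = 0) (h2 : w.snd = 0) :
    w = 0 := by
  have := WithLp.prod_norm_sq_eq_of_L2 w
  rw [h1, h2] at this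
  simpa using this

/-- Poincaré's inequality: on a form domain that contains no nonzero function with zero gradient
and is compactly embedded in `L²`, the gradient controls the `H¹` norm. -/
theorem exists_norm_sq_le_norm_grad_sq (hV : IsClosed (V : Set (GradPair Ω)))
    (hJ : IsCompactOperator (formValue V)) (hker : ∀ w ∈ V, w.snd = 0 → w.fst = 0) :
    ∃ c : ℝ, 0 < c ∧ ∀ w : V, c * ‖w‖ ^ 2 ≤ ‖formGrad V w‖ ^ 2 := by
  have : CompleteSpace V := hV.completeSpace_coe
  by_contra! hcon
  -- A normalized sequence violating the inequality has gradients tending to zero. A subsequence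
  -- converges in `L²` by compactness, hence in the `H¹` norm, and its limit in `V` has norm one and
  -- zero gradient.
  have h1 : ∀ n : ℕ, ∃ w : V, ‖w‖ = 1 ∧ ‖formGrad V w‖ ^ 2 < 1 / ((n : ℝ) + 1) := by
    intro n
    obtain ⟨w, hw⟩ := hcon (1 / ((n : ℝ) + 1)) (by positivity)
    have hw0 : w ≠ 0 := by
      rintro rfl
      simp at hw
    have hn : ‖w‖ ≠ 0 := norm_ne_zero_iff.2 hw0
    refine ⟨‖w‖⁻¹ • w, by rw [norm_smul, norm_inv, norm_norm, inv_mul_cancel₀ hn], ?_⟩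
    rw [map_smul, norm_smul, norm_inv, norm_norm, mul_pow, inv_pow, inv_mul_lt_iff₀ (by positivity)]
    linarith
  choose w hw hgrad using h1
  have hJ' : IsCompactOperator (formValue V : V →ₗ[ℝ] Lp ℝ 2 (vol Ω)) := hJ
  obtain ⟨K, hK, hKsub⟩ := hJ'.image_closedBall_subset_compact 1
  obtain ⟨u, -, ψ, hψ, hu⟩ := hK.tendsto_subseq (x := fun n => formValue V (w n))
    fun n => hKsub ⟨w n, by simp [hw n], rfl⟩
  have hg0 : Tendsto (fun n => formGrad V (w n)) atTop (𝓝 0) := by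
    rw [tendsto_zero_iff_norm_tendsto_zero]
    have h2 : Tendsto (fun n => ‖formGrad V (w n)‖ ^ 2) atTop (𝓝 0) :=
      squeeze_zero (fun n => sq_nonneg _) (fun n => (hgrad n).le)
        tendsto_one_div_add_atTop_nhds_zero_nat
    have h3 := h2.sqrt
    simpa [Real.sqrt_sq] using h3
  have hlim : Tendsto (fun n => (w (ψ n)).1) atTop
      (𝓝 (WithLp.toLp 2 (u, (0 : Lp (Eu d) 2 (vol Ω))))) := by
    have h2 := hu.prodMk_nhds (hg0.comp hψ.tendsto_atTop)
    exact ((WithLp.prod_continuous_toLp 2 (Lp ℝ 2 (vol Ω))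
      (Lp (Eu d) 2 (vol Ω))).tendsto _).comp h2
  have hmem : WithLp.toLp 2 (u, (0 : Lp (Eu d) 2 (vol Ω))) ∈ V :=
    hV.mem_of_tendsto hlim (Eventually.of_forall fun n => (w (ψ n)).2)
  have hu0 := hker _ hmem rfl
  have hz := gradPair_eq_zero_of_fst_snd hu0 rfl
  rw [hz] at hlim
  have h4 := hlim.norm
  have h5 : (fun n => ‖(w (ψ n)).1‖) = fun _ => (1 : ℝ) := by
    funext n; exact hw (ψ n)
  rw [h5, norm_zero] at h4
  exact one_ne_zero (tendsto_nhds_unique tendsto_const_nhds h4)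

/-- Variational problems whose quadratic form `‖D v‖²` is coercive have a solution operator. -/
theorem exists_variational_solver {X L M : Type*} [NormedAddCommGroup X] [InnerProductSpace ℝ X]
    [CompleteSpace X] [NormedAddCommGroup L] [InnerProductSpace ℝ L] [CompleteSpace L]
    [NormedAddCommGroup M] [InnerProductSpace ℝ M] (J : X →L[ℝ] L) (D : X →L[ℝ] M) {c : ℝ}
    (hc : 0 < c) (hcoer : ∀ w, c * ‖w‖ ^ 2 ≤ ‖D w‖ ^ 2) :
    ∃ S : L →L[ℝ] X, ∀ f v, inner ℝ (D (S f)) (D v) = inner ℝ f (J v) := by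
  let B : X →L[ℝ] X →L[ℝ] ℝ := (innerSL ℝ).bilinearComp D D
  have hB : ∀ v w, B v w = inner ℝ (D v) (D w) := fun v w => rfl
  have hBc : IsCoercive B := by
    refine ⟨c, hc, fun u => ?_⟩
    rw [hB, real_inner_self_eq_norm_sq, mul_assoc, ← sq]
    exact hcoer u
  -- Lax-Milgram, with the functional `v ↦ ⟪f, J v⟫` represented in `X` by the adjoint of `J`.
  refine ⟨(hBc.continuousLinearEquivOfBilin.symm : X →L[ℝ] X).comp
    (ContinuousLinearMap.adjoint J), fun f v => ?_⟩
  rw [← hB, ← hBc.continuousLinearEquivOfBilin_apply, ← ContinuousLinearMap.adjoint_inner_left]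
  simp

/-- The solution operator of the Poisson problem. -/
theorem exists_poisson_solver (hV : IsClosed (V : Set (GradPair Ω)))
    (hJ : IsCompactOperator (formValue V)) (hker : ∀ w ∈ V, w.snd = 0 → w.fst = 0) :
    ∃ S : Lp ℝ 2 (vol Ω) →L[ℝ] V, ∀ f (v : V),
      inner ℝ (S f).1.snd v.1.snd = inner ℝ f v.1.fst := by
  have : CompleteSpace V := hV.completeSpace_coe
  obtain ⟨c, hc, hcoer⟩ := exists_norm_sq_le_norm_grad_sq hV hJ hker
  exact exists_variational_solver (formValue V) (formGrad V) hc hcoer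

theorem L2_inner_eq_integral_inner {α E : Type*} [MeasurableSpace α] [NormedAddCommGroup E]
    [InnerProductSpace ℝ E] {μ : Measure α} (u v : Lp E 2 μ) :
    inner ℝ u v = ∫ x, inner ℝ (u x) (v x) ∂μ := L2.inner_def u v

theorem solvesPoisson_iff {u : GradPair Ω} {f : Eu d → ℝ} {F : Lp ℝ 2 (vol Ω)}
    (hF : F =ᵐ[vol Ω] f) :
    SolvesPoisson Ω V u f ↔ u ∈ V ∧ ∀ v ∈ V, inner ℝ u.snd v.snd = inner ℝ F v.fst := by
  refine and_congr Iff.rfl (forall₂_congr fun v _ => ?_)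
  rw [L2_inner_eq_integral_inner, L2_inner_eq_integral_mul]
  have : ∫ x in Ω, F x * v.fst x = ∫ x in Ω, f x * v.fst x := by
    refine integral_congr_ae ?_
    filter_upwards [hF] with x hx
    rw [hx]
  rw [this]

/-- A nonzero function of `V` with zero gradient would itself be a zero mode. The absence of zero
modes enters Poincaré's inequality and uniqueness in this form. -/
theorem snd_eq_zero_imp_fst_eq_zero {σ : Eu d → ℝ} (hzero : ¬ ∃ Ψ : GradPair Ω, IsMode Ω V σ 0 Ψ) :
    ∀ w ∈ V, w.snd = 0 → w.fst = 0 := by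
  intro w hw h0
  by_contra hne
  refine hzero ⟨w, hne, (solvesPoisson_iff (F := 0) ?_).2 ⟨hw, fun v _ => by simp [h0]⟩⟩
  filter_upwards [Lp.coeFn_zero ℝ 2 (vol Ω)] with x hx
  rw [hx]
  simp

/-! ### The Green's function as kernel of the solution operator -/

section Solver

variable {S : Lp ℝ 2 (vol Ω) →L[ℝ] V}

/-- Solutions of the Poisson problem are unique. -/
theorem eq_solver_of_solvesPoisson (hker : ∀ w ∈ V, w.snd = 0 → w.fst = 0)
    (hS : ∀ f (v : V), inner ℝ (S f).1.snd v.1.snd = inner ℝ f v.1.fst)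
    {u : GradPair Ω} {f : Eu d → ℝ} {F : Lp ℝ 2 (vol Ω)} (hF : F =ᵐ[vol Ω] f)
    (hu : SolvesPoisson Ω V u f) : u = S F := by
  obtain ⟨huV, hu⟩ := (solvesPoisson_iff hF).1 hu
  have hmem : u - (S F).1 ∈ V := V.sub_mem huV (S F).2
  -- Both weak equations are tested with the difference of the two solutions.
  have hsnd : (u - (S F).1).snd = 0 := by
    rw [← inner_self_eq_zero (𝕜 := ℝ)]
    nth_rewrite 1 [WithLp.sub_snd]
    rw [inner_sub_left, hu _ hmem, hS F ⟨_, hmem⟩, sub_self]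
  exact sub_eq_zero.1 (gradPair_eq_zero_of_fst_snd (hker _ hmem hsnd) hsnd)

theorem solver_solvesPoisson
    (hS : ∀ f (v : V), inner ℝ (S f).1.snd v.1.snd = inner ℝ f v.1.fst)
    {f : Eu d → ℝ} {F : Lp ℝ 2 (vol Ω)} (hF : F =ᵐ[vol Ω] f) :
    SolvesPoisson Ω V (S F) f :=
  (solvesPoisson_iff hF).2 ⟨(S F).2, fun v hv => hS F ⟨v, hv⟩⟩

/-- A function in `L²` is approximated by a dominated sequence of test functions. -/
theorem exists_dominated_isTest_seq (hΩ : IsOpen Ω) (F : Lp ℝ 2 (vol Ω)) :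
    ∃ (φ : ℕ → Eu d → ℝ) (t : ℕ → Lp ℝ 2 (vol Ω)) (A : Lp ℝ 2 (vol Ω)),
      (∀ n, IsTest Ω (φ n)) ∧ (∀ n, t n =ᵐ[vol Ω] φ n) ∧ Tendsto t atTop (𝓝 F) ∧
      ∀ᵐ x ∂(vol Ω), (∀ n, ‖φ n x‖ ≤ ‖F x‖ + A x) ∧ Tendsto (fun n => φ n x) atTop (𝓝 (F x)) := by
  have hF : F ∈ closure (testSubmodule Ω : Set (Lp ℝ 2 (vol Ω))) := by
    rw [← Submodule.topologicalClosure_coe, topologicalClosure_testSubmodule hΩ]; trivial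
  -- Approximation at a summable rate: the sum `A` of all errors `|t n - F|` lies in `L²` and
  -- dominates, and summability gives convergence almost everywhere.
  have h1 : ∀ n : ℕ, ∃ t ∈ testSubmodule Ω, dist F t < (1 / 2 : ℝ) ^ n := fun n =>
    Metric.mem_closure_iff.1 hF _ (by positivity)
  choose t ht hdist using h1
  choose φ hφ htφ using ht
  have hnorm : ∀ n, ‖|t n - F|‖ ≤ (1 / 2 : ℝ) ^ n := fun n => by
    rw [norm_abs_eq_norm, ← dist_eq_norm, dist_comm]
    exact (hdist n).le
  have hsum : Summable fun n => ‖|t n - F|‖ :=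
    Summable.of_nonneg_of_le (fun _ => norm_nonneg _) hnorm summable_geometric_two
  have hsum' : ∑' n, ‖|t n - F|‖ₑ ≠ ⊤ := tsum_enorm_ne_top_iff_summable_norm.2 hsum
  refine ⟨φ, t, ∑' n, |t n - F|, hφ, htφ, ?_, ?_⟩
  · rw [tendsto_iff_norm_sub_tendsto_zero]
    simpa only [norm_abs_eq_norm] using hsum.tendsto_atTop_zero
  · filter_upwards [Lp.hasSum_coeFn_tsum hsum', ae_all_iff.2 htφ,
      ae_all_iff.2 fun n => Lp.coeFn_abs (t n - F), ae_all_iff.2 fun n => Lp.coeFn_sub (t n) F]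
      with x hx h2 h3 h4
    have h5 : ∀ n, (|t n - F| : Lp ℝ 2 (vol Ω)) x = |φ n x - F x| := fun n => by
      rw [h3 n, h4 n, Pi.sub_apply, h2 n]
    simp only [h5] at hx
    refine ⟨fun n => ?_, ?_⟩
    · have h6 : |φ n x - F x| ≤ (∑' n, |t n - F| : Lp ℝ 2 (vol Ω)) x :=
        le_hasSum hx n fun _ _ => abs_nonneg _
      have h7 := norm_add_le (F x) (φ n x - F x)
      rw [add_sub_cancel] at h7
      simp only [Real.norm_eq_abs] at h7 ⊢
      linarith
    · rw [tendsto_iff_norm_sub_tendsto_zero]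
      exact hx.summable.tendsto_atTop_zero

/-- The integral operator of a Green's function is the solution operator. -/
theorem integral_green_eq_solver (hΩ : IsOpen Ω) (hker : ∀ w ∈ V, w.snd = 0 → w.fst = 0)
    (hS : ∀ f (v : V), inner ℝ (S f).1.snd v.1.snd = inner ℝ f v.1.fst)
    {G : Eu d → Eu d → ℝ} (hG : IsGreen Ω V G) {f : Eu d → ℝ} {F : Lp ℝ 2 (vol Ω)}
    (hF : F =ᵐ[vol Ω] f) :
    (S F).1.fst =ᵐ[vol Ω] fun x => ∫ y in Ω, G x y * f y := by
  obtain ⟨φ, t, A, hφ, htφ, htF, hdom⟩ := exists_dominated_isTest_seq hΩ F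
  obtain ⟨-, hinteg, hgreen⟩ := hG
  have hsol : ∀ n, (S (t n)).1.fst =ᵐ[vol Ω] fun x => ∫ y in Ω, G x y * φ n y := fun n => by
    obtain ⟨u, hu, hsolve⟩ := hgreen (φ n) (hφ n)
    rwa [eq_solver_of_solvesPoisson hker hS (htφ n) hsolve] at hu
  have hlim : Tendsto (fun n => (S (t n)).1.fst) atTop (𝓝 (S F).1.fst) :=
    (((formValue V).comp S).continuous.tendsto F).comp htF
  -- The left side converges in `L²`, hence almost everywhere along a subsequence; the right side
  -- converges pointwise by dominated convergence, since `G x` is integrable against the `L²`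
  -- function `‖F‖ + A`.
  obtain ⟨ns, hns, hae⟩ := (tendstoInMeasure_of_tendsto_Lp hlim).exists_seq_tendsto_ae
  have hbd : MemLp (fun x => ‖F x‖ + A x) 2 (vol Ω) := (Lp.memLp F).norm.add (Lp.memLp A)
  filter_upwards [hae, ae_all_iff.2 hsol, hinteg _ hbd,
    ae_all_iff.2 fun n => hinteg _ (hφ n).memLp] with x h1 h2 h3 h4
  have hdct : Tendsto (fun n => ∫ y in Ω, G x y * φ n y) atTop (𝓝 (∫ y in Ω, G x y * f y)) := by
    refine tendsto_integral_of_dominated_convergence (fun y => ‖G x y * (‖F y‖ + A y)‖)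
      (fun n => (h4 n).1) h3.norm (fun n => ?_) ?_
    · filter_upwards [hdom] with y hy
      rw [norm_mul, norm_mul]
      refine mul_le_mul_of_nonneg_left ((hy.1 n).trans (Real.le_norm_self _)) (norm_nonneg _)
    · filter_upwards [hdom, hF] with y hy hFy
      rw [← hFy]
      exact hy.2.const_mul _
  refine tendsto_nhds_unique h1 ?_
  simp only [h2]
  exact hdct.comp hns.tendsto_atTop

end Solver

end Poisson

/-! ### Convergence in `L²` and almost everywhere -/

section Convergence

variable {d : ℕ} {Ω : Set (Eu d)}

theorem Converges.congr {F F' : ℕ → Eu d → ℝ} {f f' : Eu d → ℝ} (h : Converges Ω F f)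
    (hF : ∀ p, F p =ᵐ[vol Ω] F' p) (hf : f =ᵐ[vol Ω] f') : Converges Ω F' f' := by
  refine ⟨h.1.congr fun p => eLpNorm_congr_ae ?_, ?_⟩
  · filter_upwards [hF p, hf] with x h1 h2
    rw [h1, h2]
  · filter_upwards [h.2, ae_all_iff.2 hF, hf] with x h1 h2 h3
    rw [← h3]
    exact h1.congr h2

/-- Summable `L²` errors are pointwise summable almost everywhere, so no subsequence is needed. The
shift to `F (p + 1)` serves `Ξ p / √σ`, which need not be in `L²` for `p = 0`. -/
theorem converges_of_geometric {F : ℕ → Eu d → ℝ} {f : Eu d → ℝ} {a : ℕ → Lp ℝ 2 (vol Ω)}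
    {b : Lp ℝ 2 (vol Ω)} (hF : ∀ p, F (p + 1) =ᵐ[vol Ω] a p) (hf : f =ᵐ[vol Ω] b) {C r : ℝ}
    (hr0 : 0 ≤ r) (hr1 : r < 1) (hb : ∀ p, ‖a p - b‖ ≤ C * r ^ p) : Converges Ω F f := by
  have hsum : Summable fun p => ‖a p - b‖ :=
    Summable.of_nonneg_of_le (fun _ => norm_nonneg _) hb
      ((summable_geometric_of_lt_one hr0 hr1).mul_left C)
  have hdiff : ∀ p, (fun x => F (p + 1) x - f x) =ᵐ[vol Ω] (a p - b : Lp ℝ 2 (vol Ω)) := by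
    intro p
    filter_upwards [hF p, hf, Lp.coeFn_sub (a p) b] with x h1 h2 h3
    rw [h1, h2, h3, Pi.sub_apply]
  refine ⟨?_, ?_⟩
  · rw [← tendsto_add_atTop_iff_nat 1]
    have h1 : ∀ p, eLpNorm (fun x => F (p + 1) x - f x) 2 (vol Ω)
        = ENNReal.ofReal ‖a p - b‖ := fun p => by
      rw [eLpNorm_congr_ae (hdiff p), Lp.norm_def, ENNReal.ofReal_toReal (Lp.eLpNorm_ne_top _)]
    simp only [h1]
    simpa using ENNReal.tendsto_ofReal hsum.tendsto_atTop_zero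
  · have hsum' : ∑' p, ‖a p - b‖ₑ ≠ ⊤ := tsum_enorm_ne_top_iff_summable_norm.2 hsum
    filter_upwards [Lp.hasSum_coeFn_tsum hsum', ae_all_iff.2 hdiff] with x h1 h2
    rw [← tendsto_add_atTop_iff_nat 1, tendsto_iff_norm_sub_tendsto_zero]
    have h3 := h1.summable.tendsto_atTop_zero.norm
    rw [norm_zero] at h3
    refine h3.congr fun p => ?_
    rw [← h2 p]

theorem Converges.mul_tendsto {F : ℕ → Eu d → ℝ} {f : Eu d → ℝ} (h : Converges Ω F f)
    (hf : MemLp f 2 (vol Ω)) (hF : ∀ p, AEStronglyMeasurable (F p) (vol Ω)) {c : ℕ → ℝ} {l : ℝ}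
    (hc : Tendsto c atTop (𝓝 l)) :
    Converges Ω (fun p x => c p * F p x) (fun x => l * f x) := by
  refine ⟨?_, ?_⟩
  · have hle : ∀ p, eLpNorm (fun x => c p * F p x - l * f x) 2 (vol Ω)
        ≤ ‖c p‖ₑ * eLpNorm (fun x => F p x - f x) 2 (vol Ω)
          + ‖c p - l‖ₑ * eLpNorm f 2 (vol Ω) := by
      intro p
      have h1 : (fun x => c p * F p x - l * f x)
          = c p • (fun x => F p x - f x) + (c p - l) • f := by
        funext x
        simp only [Pi.add_apply, Pi.smul_apply, smul_eq_mul]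
        ring
      rw [h1, ← eLpNorm_const_smul, ← eLpNorm_const_smul]
      exact eLpNorm_add_le (((hF p).sub hf.1).const_smul _) (hf.1.const_smul _) (by norm_num)
    have h2 : Tendsto (fun p => ‖c p‖ₑ * eLpNorm (fun x => F p x - f x) 2 (vol Ω)
          + ‖c p - l‖ₑ * eLpNorm f 2 (vol Ω)) atTop (𝓝 (‖l‖ₑ * 0 + 0 * eLpNorm f 2 (vol Ω))) := by
      refine Tendsto.add ?_ ?_
      · exact ENNReal.Tendsto.mul hc.enorm (Or.inr ENNReal.zero_ne_top)
          h.1 (Or.inr enorm_ne_top)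
      · refine ENNReal.Tendsto.mul_const ?_ (Or.inr hf.2.ne)
        have h3 : Tendsto (fun p => c p - l) atTop (𝓝 0) := by simpa using hc.sub_const l
        simpa using h3.enorm
    rw [mul_zero, zero_mul, add_zero] at h2
    exact tendsto_of_tendsto_of_tendsto_of_le_of_le tendsto_const_nhds h2 (fun _ => zero_le) hle
  · filter_upwards [h.2] with x hx
    exact hc.mul hx

theorem l2norm_eq_norm {f : Eu d → ℝ} {F : Lp ℝ 2 (vol Ω)} (hF : F =ᵐ[vol Ω] f) :
    l2norm Ω f = ‖F‖ := by
  rw [l2norm, ← Real.sqrt_sq (norm_nonneg F), ← real_inner_self_eq_norm_sq,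
    L2_inner_eq_integral_mul]
  congr 1
  refine integral_congr_ae ?_
  filter_upwards [hF] with x hx
  rw [hx, sq]

theorem ConvergesToMode.congr {σ : Eu d → ℝ} {Ξ : ℕ → Eu d → ℝ} {E : ℝ} {Ψ Ψ' : Eu d → ℝ}
    (h : ConvergesToMode Ω σ Ξ E Ψ) (hΨ : Ψ =ᵐ[vol Ω] Ψ') : ConvergesToMode Ω σ Ξ E Ψ' := by
  have hnorm : l2norm Ω (fun y => √(σ y) * Ψ y) = l2norm Ω (fun y => √(σ y) * Ψ' y) := by
    unfold l2norm
    congr 1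
    refine integral_congr_ae ?_
    filter_upwards [hΨ] with x hx
    rw [hx]
  unfold ConvergesToMode
  rw [← hnorm]
  refine ⟨h.1.congr (fun _ => .rfl) ?_, h.2.1.congr (fun _ => .rfl) hΨ,
    h.2.2.1.congr (fun _ => .rfl) ?_, h.2.2.2.congr (fun _ => .rfl) ?_⟩ <;>
  · filter_upwards [hΨ] with x hx
    rw [hx]

end Convergence

/-! ### The weighted operator and its correspondence with modes -/

section Density

variable {d : ℕ} {Ω : Set (Eu d)} {V : Submodule ℝ (GradPair Ω)} {σ : Eu d → ℝ}

/-- Multiplication by a bounded function on `L²`. -/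
theorem exists_mul_operator {s : Eu d → ℝ} (hs : AEStronglyMeasurable s (vol Ω)) {M : ℝ}
    (hM : ∀ᵐ x ∂(vol Ω), ‖s x‖ ≤ M) :
    ∃ A : Lp ℝ 2 (vol Ω) →L[ℝ] Lp ℝ 2 (vol Ω), ∀ f, A f =ᵐ[vol Ω] fun x => s x * f x := by
  have hs' : MemLp s ⊤ (vol Ω) := memLp_top_of_bound hs M hM
  refine ⟨(ContinuousLinearMap.mul ℝ ℝ).holderL (vol Ω) ⊤ 2 2 (hs'.toLp s), fun f => ?_⟩
  filter_upwards [(ContinuousLinearMap.mul ℝ ℝ).coeFn_holder (r := 2) (hs'.toLp s) f,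
    hs'.coeFn_toLp] with x h1 h2
  rw [ContinuousLinearMap.holderL_apply_apply, h1, h2]
  rfl

variable {S : Lp ℝ 2 (vol Ω) →L[ℝ] V} {A : Lp ℝ 2 (vol Ω) →L[ℝ] Lp ℝ 2 (vol Ω)}

theorem inner_mul_operator_comm {s : Eu d → ℝ} (hA : ∀ f, A f =ᵐ[vol Ω] fun x => s x * f x)
    (f g : Lp ℝ 2 (vol Ω)) : inner ℝ (A f) g = inner ℝ f (A g) := by
  rw [L2_inner_eq_integral_mul, L2_inner_eq_integral_mul]
  refine integral_congr_ae ?_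
  filter_upwards [hA f, hA g] with x h1 h2
  rw [h1, h2]
  ring

theorem mul_operator_injective (hσ : ∀ᵐ x ∂(vol Ω), 0 < σ x)
    (hA : ∀ f, A f =ᵐ[vol Ω] fun x => √(σ x) * f x) {f : Lp ℝ 2 (vol Ω)} (h : A f = 0) :
    f = 0 := by
  refine Lp.eq_zero_iff_ae_eq_zero.2 ?_
  have h0 := Lp.eq_zero_iff_ae_eq_zero.1 h
  filter_upwards [hσ, hA f, h0] with x h1 h2 h3
  rw [h2] at h3
  exact (mul_eq_zero.1 h3).resolve_left (Real.sqrt_pos.2 h1).ne'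

/-- The inverse of `Ô`: solve the Poisson problem, with the weight `√σ` on both sides. -/
noncomputable def weightedSolver (S : Lp ℝ 2 (vol Ω) →L[ℝ] V)
    (A : Lp ℝ 2 (vol Ω) →L[ℝ] Lp ℝ 2 (vol Ω)) : Lp ℝ 2 (vol Ω) →L[ℝ] Lp ℝ 2 (vol Ω) :=
  A.comp (((formValue V).comp S).comp A)

theorem weightedSolver_apply (f : Lp ℝ 2 (vol Ω)) :
    weightedSolver S A f = A (S (A f)).1.fst := rfl

theorem isCompactOperator_weightedSolver (hJ : IsCompactOperator (formValue V)) :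
    IsCompactOperator (weightedSolver S A) :=
  ((hJ.comp_clm S).comp_clm A).clm_comp A

theorem inner_solver (hS : ∀ f (v : V), inner ℝ (S f).1.snd v.1.snd = inner ℝ f v.1.fst)
    (f g : Lp ℝ 2 (vol Ω)) : inner ℝ (S f).1.fst g = inner ℝ (S f).1.snd (S g).1.snd := by
  rw [real_inner_comm, ← hS g (S f), real_inner_comm]

/-- `⟪T f, g⟫` is the Dirichlet inner product of the solutions with right sides `A f` and `A g`,
which is symmetric and nonnegative on the diagonal. -/
theorem isPositive_weightedSolver
    (hS : ∀ f (v : V), inner ℝ (S f).1.snd v.1.snd = inner ℝ f v.1.fst)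
    {s : Eu d → ℝ} (hA : ∀ f, A f =ᵐ[vol Ω] fun x => s x * f x) :
    (weightedSolver S A).IsPositive := by
  have key : ∀ f g, inner ℝ (weightedSolver S A f) g
      = inner ℝ (S (A f)).1.snd (S (A g)).1.snd := fun f g => by
    rw [weightedSolver_apply, inner_mul_operator_comm hA, inner_solver hS]
  refine ⟨fun f g => ?_, fun f => ?_⟩
  · change inner ℝ (weightedSolver S A f) g = inner ℝ f (weightedSolver S A g)
    rw [key, real_inner_comm, ← key, real_inner_comm]
  · change 0 ≤ RCLike.re (inner ℝ (weightedSolver S A f) f)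
    rw [key]
    exact real_inner_self_nonneg (x := (S (A f)).1.snd)

/-- A vanishing solution has zero gradient, by testing with itself. Then `f` is orthogonal to all of
`V`, which contains the test functions. -/
theorem solver_injective (hΩ : IsOpen Ω) (hV : sobolevH10 Ω ⊆ V)
    (hS : ∀ f (v : V), inner ℝ (S f).1.snd v.1.snd = inner ℝ f v.1.fst)
    {f : Lp ℝ 2 (vol Ω)} (h : (S f).1.fst = 0) : f = 0 := by
  have h1 : inner ℝ (S f).1.snd (S f).1.snd = (0 : ℝ) := by
    rw [hS f (S f), h, inner_zero_right]
  have h2 : (S f).1.snd = 0 := inner_self_eq_zero.1 h1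
  have horth : f ∈ (testSubmodule Ω)ᗮ := by
    rintro u ⟨φ, hφ, hu⟩
    have hcont : Continuous (gradient φ) := by
      have h3 : Continuous (fderiv ℝ φ) := hφ.1.continuous_fderiv (by simp)
      exact (InnerProductSpace.toDual ℝ (Eu d)).symm.continuous.comp h3
    have hsupp : HasCompactSupport (gradient φ) := by
      refine (hφ.2.1.fderiv ℝ).mono fun x hx => ?_
      rw [Function.mem_support] at hx ⊢
      contrapose! hx
      simp [gradient, hx]
    have hgrad : MemLp (gradient φ) 2 (vol Ω) := hcont.memLp_of_hasCompactSupport hsupp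
    let w : GradPair Ω := WithLp.toLp 2 (u, hgrad.toLp _)
    have hw : w ∈ V := hV (subset_closure ⟨φ, hφ, hu, hgrad.coeFn_toLp⟩)
    have h4 := hS f ⟨w, hw⟩
    rw [h2, inner_zero_left] at h4
    rw [real_inner_comm]
    exact h4.symm
  have hbot : (testSubmodule Ω)ᗮ = ⊥ :=
    (Submodule.topologicalClosure_eq_top_iff).1 (topologicalClosure_testSubmodule hΩ)
  rw [hbot] at horth
  exact (Submodule.mem_bot ℝ).1 horth

theorem weightedSolver_injective (hΩ : IsOpen Ω) (hV : sobolevH10 Ω ⊆ V)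
    (hS : ∀ f (v : V), inner ℝ (S f).1.snd v.1.snd = inner ℝ f v.1.fst)
    (hσ : ∀ᵐ x ∂(vol Ω), 0 < σ x) (hA : ∀ f, A f =ᵐ[vol Ω] fun x => √(σ x) * f x)
    (f : Lp ℝ 2 (vol Ω)) (h : weightedSolver S A f = 0) : f = 0 :=
  mul_operator_injective hσ hA (solver_injective hΩ hV hS (mul_operator_injective hσ hA h))

theorem coeFn_mul_operator_twice (hσ : ∀ᵐ x ∂(vol Ω), 0 < σ x)
    (hA : ∀ f, A f =ᵐ[vol Ω] fun x => √(σ x) * f x) (f : Lp ℝ 2 (vol Ω)) :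
    A (A f) =ᵐ[vol Ω] fun x => σ x * f x := by
  filter_upwards [hσ, hA f, hA (A f)] with x h1 h2 h3
  rw [h3, h2, ← mul_assoc, Real.mul_self_sqrt h1.le]

theorem isMode_rhs (hσ : ∀ᵐ x ∂(vol Ω), 0 < σ x)
    (hA : ∀ f, A f =ᵐ[vol Ω] fun x => √(σ x) * f x) (E : ℝ) (f : Lp ℝ 2 (vol Ω)) :
    (E • A (A f) : Lp ℝ 2 (vol Ω)) =ᵐ[vol Ω] fun x => E * σ x * f x := by
  filter_upwards [Lp.coeFn_smul E (A (A f)), coeFn_mul_operator_twice hσ hA f] with x h1 h2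
  rw [h1, Pi.smul_apply, h2, smul_eq_mul, mul_assoc]

/-- Testing with the mode itself gives `‖∇Ψ‖² = E ‖√σ Ψ‖²`. -/
theorem IsMode.eigenvalue_pos (hzero : ¬ ∃ Ψ : GradPair Ω, IsMode Ω V σ 0 Ψ)
    (hσ : ∀ᵐ x ∂(vol Ω), 0 < σ x) (hA : ∀ f, A f =ᵐ[vol Ω] fun x => √(σ x) * f x)
    {E : ℝ} {Ψ : GradPair Ω} (hΨ : IsMode Ω V σ E Ψ) : 0 < E := by
  have hE : E ≠ 0 := by
    rintro rfl
    exact hzero ⟨Ψ, hΨ⟩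
  obtain ⟨hV, h⟩ := (solvesPoisson_iff (isMode_rhs hσ hA E Ψ.fst)).1 hΨ.2
  have h1 := h Ψ hV
  rw [inner_smul_left, inner_mul_operator_comm hA] at h1
  have h2 : (0 : ℝ) < inner ℝ (A Ψ.fst) (A Ψ.fst) :=
    real_inner_self_pos.2 fun h0 => hΨ.1 (mul_operator_injective hσ hA h0)
  have h3 : (0 : ℝ) ≤ inner ℝ Ψ.snd Ψ.snd := real_inner_self_nonneg
  rw [h1] at h3
  exact lt_of_le_of_ne (nonneg_of_mul_nonneg_left h3 h2) hE.symm

/-- A mode is recovered from `√σ Ψ` by solving the Poisson problem. -/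
theorem IsMode.eq_smul_solver (hker : ∀ w ∈ V, w.snd = 0 → w.fst = 0)
    (hS : ∀ f (v : V), inner ℝ (S f).1.snd v.1.snd = inner ℝ f v.1.fst)
    (hσ : ∀ᵐ x ∂(vol Ω), 0 < σ x) (hA : ∀ f, A f =ᵐ[vol Ω] fun x => √(σ x) * f x)
    {E : ℝ} {Ψ : GradPair Ω} (hΨ : IsMode Ω V σ E Ψ) :
    Ψ.fst = E • (S (A (A Ψ.fst))).1.fst := by
  have h := eq_solver_of_solvesPoisson hker hS (isMode_rhs hσ hA E Ψ.fst) hΨ.2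
  conv_lhs => rw [h, map_smul]
  rfl

theorem IsMode.weightedSolver_eq (hker : ∀ w ∈ V, w.snd = 0 → w.fst = 0)
    (hS : ∀ f (v : V), inner ℝ (S f).1.snd v.1.snd = inner ℝ f v.1.fst)
    (hσ : ∀ᵐ x ∂(vol Ω), 0 < σ x) (hA : ∀ f, A f =ᵐ[vol Ω] fun x => √(σ x) * f x)
    {E : ℝ} (hE : 0 < E) {Ψ : GradPair Ω} (hΨ : IsMode Ω V σ E Ψ) :
    weightedSolver S A (A Ψ.fst) = E⁻¹ • A Ψ.fst := by
  have h := hΨ.eq_smul_solver hker hS hσ hA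
  rw [weightedSolver_apply]
  conv_rhs => rw [h, map_smul, smul_smul, inv_mul_cancel₀ hE.ne', one_smul]

/-- Since `σ` may approach zero, `φ / √σ` is not obviously in `V`. The mode is instead defined as a
Poisson solution, and the eigenvalue equation shows that `√σ` times it is `φ`. -/
theorem exists_isMode_of_eigenvector
    (hS : ∀ f (v : V), inner ℝ (S f).1.snd v.1.snd = inner ℝ f v.1.fst)
    (hσ : ∀ᵐ x ∂(vol Ω), 0 < σ x) (hA : ∀ f, A f =ᵐ[vol Ω] fun x => √(σ x) * f x)
    {μ : ℝ} (hμ : 0 < μ) {φ : Lp ℝ 2 (vol Ω)} (hφ0 : φ ≠ 0)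
    (hφ : weightedSolver S A φ = μ • φ) :
    ∃ Ψ : GradPair Ω, IsMode Ω V σ μ⁻¹ Ψ ∧ A Ψ.fst = φ := by
  let Ψ : GradPair Ω := S (μ⁻¹ • A φ)
  have hfst : Ψ.fst = μ⁻¹ • (S (A φ)).1.fst := by
    simp only [Ψ, map_smul]
    rfl
  have hAΨ : A Ψ.fst = φ := by
    rw [hfst, map_smul, ← weightedSolver_apply, hφ, smul_smul, inv_mul_cancel₀ hμ.ne', one_smul]
  refine ⟨Ψ, ⟨fun h0 => hφ0 (by rw [← hAΨ, h0, map_zero]), ?_⟩, hAΨ⟩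
  refine solver_solvesPoisson hS ?_
  rw [← hAΨ]
  exact isMode_rhs hσ hA μ⁻¹ Ψ.fst

theorem overlap_eq_inner (hA : ∀ f, A f =ᵐ[vol Ω] fun x => √(σ x) * f x) (Ψ : GradPair Ω)
    {Ξ₀ : Eu d → ℝ} {ξ : Lp ℝ 2 (vol Ω)} (hξ : ξ =ᵐ[vol Ω] Ξ₀) :
    overlap Ω σ Ψ Ξ₀ = inner ℝ (A Ψ.fst) ξ := by
  rw [overlap, L2_inner_eq_integral_mul]
  refine integral_congr_ae ?_
  filter_upwards [hA Ψ.fst, hξ] with x h1 h2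
  rw [h1, h2]

theorem greenStep_eq_weightedSolver (hΩ : IsOpen Ω) (hker : ∀ w ∈ V, w.snd = 0 → w.fst = 0)
    (hS : ∀ f (v : V), inner ℝ (S f).1.snd v.1.snd = inner ℝ f v.1.fst)
    (hA : ∀ f, A f =ᵐ[vol Ω] fun x => √(σ x) * f x)
    {G : Eu d → Eu d → ℝ} (hG : IsGreen Ω V G) {f : Eu d → ℝ} {F : Lp ℝ 2 (vol Ω)}
    (hF : F =ᵐ[vol Ω] f) : weightedSolver S A F =ᵐ[vol Ω] greenStep Ω σ G f := by
  have hAF : A F =ᵐ[vol Ω] fun x => √(σ x) * f x := by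
    filter_upwards [hA F, hF] with x h1 h2
    rw [h1, h2]
  filter_upwards [hA (S (A F)).1.fst, integral_green_eq_solver hΩ hker hS hG hAF] with x h1 h2
  rw [weightedSolver_apply, h1, h2, greenStep]

theorem xiSeq_eq_pow (hΩ : IsOpen Ω) (hker : ∀ w ∈ V, w.snd = 0 → w.fst = 0)
    (hS : ∀ f (v : V), inner ℝ (S f).1.snd v.1.snd = inner ℝ f v.1.fst)
    (hA : ∀ f, A f =ᵐ[vol Ω] fun x => √(σ x) * f x)
    {G : Eu d → Eu d → ℝ} (hG : IsGreen Ω V G) {Ξ₀ : Eu d → ℝ} {ξ : Lp ℝ 2 (vol Ω)}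
    (hξ : ξ =ᵐ[vol Ω] Ξ₀) (p : ℕ) :
    (weightedSolver S A ^ p) ξ =ᵐ[vol Ω] xiSeq Ω σ G Ξ₀ p := by
  induction p with
  | zero => exact hξ
  | succ p ih =>
    rw [pow_succ', ContinuousLinearMap.mul_def, ContinuousLinearMap.comp_apply]
    exact greenStep_eq_weightedSolver hΩ hker hS hA hG ih

/-- The four limits, for a sequence of iterates whose rescaling converges at a geometric rate. -/
theorem convergesToMode_of_geometric (hker : ∀ w ∈ V, w.snd = 0 → w.fst = 0)
    (hS : ∀ f (v : V), inner ℝ (S f).1.snd v.1.snd = inner ℝ f v.1.fst)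
    (hσ : ∀ᵐ x ∂(vol Ω), 0 < σ x) (hσm : AEMeasurable σ (vol Ω))
    (hA : ∀ f, A f =ᵐ[vol Ω] fun x => √(σ x) * f x)
    {Ξ : ℕ → Eu d → ℝ} {ξ : Lp ℝ 2 (vol Ω)}
    (hΞ : ∀ p, (weightedSolver S A ^ p) ξ =ᵐ[vol Ω] Ξ p) {E : ℝ} (hE : 0 < E) {Ψ : GradPair Ω}
    (hΨ : IsMode Ω V σ E Ψ) {C r : ℝ} (hr0 : 0 ≤ r) (hr1 : r < 1)
    (hb : ∀ p : ℕ, ‖E ^ p • (weightedSolver S A ^ p) ξ - A Ψ.fst‖ ≤ C * r ^ p) :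
    ConvergesToMode Ω σ Ξ E Ψ.fst := by
  set T := weightedSolver S A
  set φ := A Ψ.fst
  have hsm : AEStronglyMeasurable (fun x => √(σ x)) (vol Ω) := hσm.sqrt.aestronglyMeasurable
  have hφ0 : ‖φ‖ ≠ 0 := norm_ne_zero_iff.2 fun h0 => hΨ.1 (mul_operator_injective hσ hA h0)
  have hΞm : ∀ p, AEStronglyMeasurable (Ξ p) (vol Ω) := fun p =>
    (Lp.aestronglyMeasurable _).congr (hΞ p)
  have hscale : ∀ p, (fun x => E ^ p * Ξ p x) =ᵐ[vol Ω] (E ^ p • (T ^ p) ξ : Lp ℝ 2 (vol Ω)) := by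
    intro p
    filter_upwards [hΞ p, Lp.coeFn_smul (E ^ p) ((T ^ p) ξ)] with x h1 h2
    rw [h2, Pi.smul_apply, h1, smul_eq_mul]
  have hlim1 : Converges Ω (fun p x => E ^ p * Ξ p x) (fun x => √(σ x) * Ψ.fst x) := by
    refine converges_of_geometric (a := fun p => E ^ (p + 1) • (T ^ (p + 1)) ξ) (b := φ)
      (C := C * r) (fun p => hscale (p + 1)) (hA Ψ.fst).symm hr0 hr1 fun p => ?_
    rw [mul_assoc, ← pow_succ']
    exact hb (p + 1)
  -- `T` without its last factor `√σ`. Division by `√σ` may be unbounded on `L²`, but `Ξ (p + 1) /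
  -- √σ` is the image of `Ξ p` under the bounded `L`, so the geometric rate carries over.
  let L : Lp ℝ 2 (vol Ω) →L[ℝ] Lp ℝ 2 (vol Ω) := ((formValue V).comp S).comp A
  have hLφ : E • L φ = Ψ.fst := (hΨ.eq_smul_solver hker hS hσ hA).symm
  have hlim2 : Converges Ω (fun p x => E ^ p * (Ξ p x / √(σ x))) Ψ.fst := by
    refine converges_of_geometric (a := fun p => E • L (E ^ p • (T ^ p) ξ)) (b := Ψ.fst)
      (C := ‖E • L‖ * C) (r := r) (fun p => ?_) .rfl hr0 hr1 fun p => ?_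
    · have h1 : (T ^ (p + 1)) ξ = A (L ((T ^ p) ξ)) := by
        rw [pow_succ', ContinuousLinearMap.mul_def, ContinuousLinearMap.comp_apply]
        rfl
      have h2 : E • L (E ^ p • (T ^ p) ξ) = E ^ (p + 1) • L ((T ^ p) ξ) := by
        rw [map_smul, smul_smul, ← pow_succ']
      rw [h2]
      filter_upwards [hσ, hΞ (p + 1), hA (L ((T ^ p) ξ)),
        Lp.coeFn_smul (E ^ (p + 1)) (L ((T ^ p) ξ))] with x h3 h4 h5 h6
      have h7 : √(σ x) ≠ 0 := (Real.sqrt_pos.2 h3).ne'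
      rw [h6, Pi.smul_apply, ← h4, h1, h5, smul_eq_mul, mul_div_cancel_left₀ _ h7]
    · rw [← hLφ, ← smul_sub, ← map_sub, ← smul_apply, mul_assoc]
      exact ((E • L).le_opNorm _).trans (by gcongr; exact hb p)
  have hnorm : ∀ p, l2norm Ω (Ξ p) = ‖(T ^ p) ξ‖ := fun p => l2norm_eq_norm (hΞ p)
  have hnormφ : l2norm Ω (fun y => √(σ y) * Ψ.fst y) = ‖φ‖ := l2norm_eq_norm (hA Ψ.fst)
  -- Normalizing by the norm amounts to multiplying the `E ^ p`-scaled sequences by this convergent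
  -- scalar, as the powers of `E` cancel.
  have hc : Tendsto (fun p => (E ^ p * ‖(T ^ p) ξ‖)⁻¹) atTop (𝓝 ‖φ‖⁻¹) := by
    refine Tendsto.inv₀ ?_ hφ0
    have h1 : Tendsto (fun p => E ^ p • (T ^ p) ξ) atTop (𝓝 φ) := by
      rw [tendsto_iff_norm_sub_tendsto_zero]
      refine squeeze_zero (fun _ => norm_nonneg _) hb ?_
      simpa using (tendsto_pow_atTop_nhds_zero_of_lt_one hr0 hr1).const_mul C
    refine h1.norm.congr fun p => ?_
    rw [norm_smul, Real.norm_of_nonneg (by positivity)]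
  have hcancel : ∀ (p : ℕ) (y : ℝ),
      (E ^ p * ‖(T ^ p) ξ‖)⁻¹ * (E ^ p * y) = y / ‖(T ^ p) ξ‖ := fun p y => by
    have : E ^ p ≠ 0 := by positivity
    rw [mul_inv, mul_mul_mul_comm, inv_mul_cancel₀ this, one_mul, mul_comm, div_eq_mul_inv]
  refine ⟨hlim1, hlim2, ?_, ?_⟩
  · have h1 := hlim1.mul_tendsto ((memLp_congr_ae (hA Ψ.fst)).1 (Lp.memLp _))
      (fun p => (hΞm p).const_mul _) hc
    simp only [hnorm, hnormφ]
    refine h1.congr (fun p => ae_of_all _ fun x => hcancel p _) (ae_of_all _ fun x => ?_)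
    simp only
    rw [mul_comm, div_eq_mul_inv]
  · have h1 := hlim2.mul_tendsto (Lp.memLp _)
      (fun p => (((hΞm p).aemeasurable.div hσm.sqrt).aestronglyMeasurable).const_mul _) hc
    simp only [hnorm, hnormφ]
    refine h1.congr (fun p => ae_of_all _ fun x => hcancel p _) (ae_of_all _ fun x => ?_)
    simp only
    rw [mul_comm, div_eq_mul_inv]

end Density

/-! ### The main theorem -/

theorem theorem1 {d : ℕ} (Ω : Set (Eu d)) (hΩ : IsOpen Ω) (hbdd : Bornology.IsBounded Ω)
    (V : Submodule ℝ (GradPair Ω)) (hV : IsBoundaryCondition Ω V) (hext : HasExtension Ω V)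
    (σ : Eu d → ℝ) (hσm : AEMeasurable σ (vol Ω)) (hσpos : ∀ x ∈ Ω, 0 < σ x)
    (hσbdd : ∃ M : ℝ, ∀ x ∈ Ω, σ x ≤ M)
    (hzero : ¬ ∃ Ψ : GradPair Ω, IsMode Ω V σ 0 Ψ)
    (G : Eu d → Eu d → ℝ) (hG : IsGreen Ω V G) :
    -- the integral operator of the iteration is the inverse of `Ô`
    (∀ f h : Eu d → ℝ, MemLp h 2 (vol Ω) →
      (IsOhat Ω V σ f h ↔ f =ᵐ[vol Ω] greenStep Ω σ G h)) ∧
    -- all eigenvalues are positive, and there is a lowest one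
    (∀ (E : ℝ) (Ψ : GradPair Ω), IsMode Ω V σ E Ψ → 0 < E) ∧
    (Ω.Nonempty → ∃ E₀ : ℝ, IsLeast {E : ℝ | ∃ Ψ, IsMode Ω V σ E Ψ} E₀) ∧
    ∀ Ξ₀ : Eu d → ℝ, MemLp Ξ₀ 2 (vol Ω) →
      -- the sequence is well defined
      (∀ p : ℕ, MemLp (xiSeq Ω σ G Ξ₀ p) 2 (vol Ω) ∧
        ∀ᵐ x ∂(vol Ω),
          Integrable (fun y => G x y * (√(σ y) * xiSeq Ω σ G Ξ₀ p y)) (vol Ω)) ∧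
      -- convergence to the lowest mode that overlaps `Ξ₀`, namely the component of `Ξ₀` in the
      -- corresponding eigenspace
      (¬ Ξ₀ =ᵐ[vol Ω] 0 → ∃ (E : ℝ) (Ψ : GradPair Ω),
        IsLeast {E' : ℝ | ∃ Ψ', IsMode Ω V σ E' Ψ' ∧ overlap Ω σ Ψ' Ξ₀ ≠ 0} E ∧
        IsMode Ω V σ E Ψ ∧
        (∀ Ψ' : GradPair Ω, IsMode Ω V σ E Ψ' →
          overlap Ω σ Ψ' (fun x => √(σ x) * Ψ.fst x) = overlap Ω σ Ψ' Ξ₀) ∧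
        ConvergesToMode Ω σ (xiSeq Ω σ G Ξ₀) E Ψ.fst) ∧
      -- the case where `Ξ₀` overlaps a fundamental mode
      (∀ (E₀ : ℝ) (Ψ₀ : GradPair Ω), IsLeast {E : ℝ | ∃ Ψ, IsMode Ω V σ E Ψ} E₀ →
        IsMode Ω V σ E₀ Ψ₀ → overlap Ω σ Ψ₀ Ξ₀ ≠ 0 →
        (∃ Ψ : GradPair Ω, IsMode Ω V σ E₀ Ψ ∧
          ConvergesToMode Ω σ (xiSeq Ω σ G Ξ₀) E₀ Ψ.fst) ∧
        -- if the fundamental mode is unique up to a factor and normalized, it is the limit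
        ((∀ Ψ : GradPair Ω, IsMode Ω V σ E₀ Ψ → ∃ c : ℝ, Ψ = c • Ψ₀) →
          ∫ x in Ω, σ x * Ψ₀.fst x ^ 2 = 1 →
          ConvergesToMode Ω σ (xiSeq Ω σ G Ξ₀) E₀
            (fun x => overlap Ω σ Ψ₀ Ξ₀ * Ψ₀.fst x) ∧
          Converges Ω
            (fun p x => Real.sign (overlap Ω σ Ψ₀ Ξ₀) *
              (xiSeq Ω σ G Ξ₀ p x / √(σ x) / l2norm Ω (xiSeq Ω σ G Ξ₀ p)))
            Ψ₀.fst)) := by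
  obtain ⟨hVc, hV0, -⟩ := hV
  obtain ⟨M, hM⟩ := hσbdd
  have hσ : ∀ᵐ x ∂(vol Ω), 0 < σ x := ae_restrict_of_forall_mem hΩ.measurableSet hσpos
  have hker := snd_eq_zero_imp_fst_eq_zero hzero
  have hJ := isCompactOperator_formValue hbdd hext
  obtain ⟨S, hS⟩ := exists_poisson_solver hVc hJ hker
  obtain ⟨A, hA⟩ := exists_mul_operator (Ω := Ω) (s := fun x => √(σ x)) (M := √M)
    hσm.sqrt.aestronglyMeasurable (ae_restrict_of_forall_mem hΩ.measurableSet fun x hx => by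
      rw [Real.norm_of_nonneg (Real.sqrt_nonneg _)]
      exact Real.sqrt_le_sqrt (hM x hx))
  have hTc := isCompactOperator_weightedSolver (S := S) (A := A) hJ
  have hTp := isPositive_weightedSolver hS hA
  have hTi := weightedSolver_injective hΩ hV0 hS hσ hA
  have hpos : ∀ (E : ℝ) (Ψ : GradPair Ω), IsMode Ω V σ E Ψ → 0 < E :=
    fun E Ψ hΨ => hΨ.eigenvalue_pos hzero hσ hA
  have hAne : ∀ {E : ℝ} {Ψ : GradPair Ω}, IsMode Ω V σ E Ψ → A Ψ.fst ≠ 0 :=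
    fun hΨ h0 => hΨ.1 (mul_operator_injective hσ hA h0)
  have heig : ∀ {E : ℝ} {Ψ : GradPair Ω}, IsMode Ω V σ E Ψ →
      weightedSolver S A (A Ψ.fst) = E⁻¹ • A Ψ.fst :=
    fun hΨ => hΨ.weightedSolver_eq hker hS hσ hA (hpos _ _ hΨ)
  refine ⟨?_, hpos, ?_, ?_⟩
  · intro f h hh
    have hF := hh.coeFn_toLp
    have hAF : A (hh.toLp h) =ᵐ[vol Ω] fun x => √(σ x) * h x := by
      filter_upwards [hA (hh.toLp h), hF] with x h1 h2
      rw [h1, h2]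
    have hstep := greenStep_eq_weightedSolver hΩ hker hS hA hG hF
    constructor
    · rintro ⟨u, hfu, hu⟩
      rw [eq_solver_of_solvesPoisson hker hS hAF hu] at hfu
      exact hfu.trans ((hA _).symm.trans hstep)
    · intro hf
      exact ⟨_, hf.trans (hstep.symm.trans (hA _)), solver_solvesPoisson hS hAF⟩
  · intro hne
    have hvol : vol Ω ≠ 0 := by
      rw [Ne, Measure.restrict_eq_zero]
      exact (hΩ.measure_pos volume hne).ne'
    have hfin : vol Ω Set.univ ≠ ⊤ := by
      rw [Measure.restrict_apply_univ]
      exact hbdd.measure_lt_top.ne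
    -- The constant `1` witnesses that `L²(Ω)` is nonzero, so the injective `T` is nonzero and its
    -- norm is an eigenvalue.
    have hone : (indicatorConstLp 2 MeasurableSet.univ hfin (1 : ℝ) : Lp ℝ 2 (vol Ω)) ≠ 0 := by
      rw [← norm_ne_zero_iff, norm_indicatorConstLp (by norm_num) (by norm_num)]
      refine mul_ne_zero (by norm_num) (Real.rpow_pos_of_pos ?_ _).ne'
      rw [measureReal_def]
      exact ENNReal.toReal_pos (by simpa using hvol) hfin
    obtain ⟨μ, hμ, ⟨w, -, hw0, hw⟩, hbound⟩ := exists_maximal_eigenvector hTc hTp ⊤ isClosed_univ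
      (fun _ _ => trivial) ⟨_, trivial, fun h0 => hone (hTi _ h0)⟩
    obtain ⟨Ψ, hΨ, -⟩ := exists_isMode_of_eigenvector hS hσ hA hμ hw0 hw
    refine ⟨μ⁻¹, ⟨Ψ, hΨ⟩, ?_⟩
    rintro E ⟨Ψ', hΨ'⟩
    have hE := hpos E Ψ' hΨ'
    have h1 := hbound (A Ψ'.fst) trivial
    rw [heig hΨ', norm_smul, norm_inv, Real.norm_of_nonneg hE.le] at h1
    have h2 := le_of_mul_le_mul_right h1 (norm_pos_iff.2 (hAne hΨ'))
    exact inv_le_of_inv_le₀ hE h2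
  · intro Ξ₀ hΞ₀
    have hξ := hΞ₀.coeFn_toLp
    set ξ := hΞ₀.toLp Ξ₀
    have hpow := fun p => xiSeq_eq_pow hΩ hker hS hA hG hξ p
    have hmem : ∀ p, MemLp (xiSeq Ω σ G Ξ₀ p) 2 (vol Ω) := fun p =>
      (memLp_congr_ae (hpow p)).1 (Lp.memLp _)
    have hlimit : ¬ Ξ₀ =ᵐ[vol Ω] 0 → ∃ (E : ℝ) (Ψ : GradPair Ω),
        IsLeast {E' : ℝ | ∃ Ψ', IsMode Ω V σ E' Ψ' ∧ overlap Ω σ Ψ' Ξ₀ ≠ 0} E ∧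
        IsMode Ω V σ E Ψ ∧
        (∀ Ψ' : GradPair Ω, IsMode Ω V σ E Ψ' →
          overlap Ω σ Ψ' (fun x => √(σ x) * Ψ.fst x) = overlap Ω σ Ψ' Ξ₀) ∧
        ConvergesToMode Ω σ (xiSeq Ω σ G Ξ₀) E Ψ.fst := by
      intro hne
      have hξ0 : ξ ≠ 0 := fun h0 => hne (hξ.symm.trans (Lp.eq_zero_iff_ae_eq_zero.1 h0))
      obtain ⟨μ, hμ, φ, hφ0, hφ, hproj, hmax, C, r, -, hr0, hr1, hb⟩ :=
        exists_power_iteration_limit hTc hTp hTi hξ0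
      obtain ⟨Ψ, hΨ, hAΨ⟩ := exists_isMode_of_eigenvector hS hσ hA hμ hφ0 hφ
      have hoverlap : ∀ Ψ' : GradPair Ω, IsMode Ω V σ μ⁻¹ Ψ' →
          overlap Ω σ Ψ' (fun x => √(σ x) * Ψ.fst x) = overlap Ω σ Ψ' Ξ₀ := by
        intro Ψ' hΨ'
        rw [overlap_eq_inner hA Ψ' hξ, overlap_eq_inner hA Ψ' (hA Ψ.fst), hAΨ]
        refine hproj _ ?_
        have := heig hΨ'
        rwa [inv_inv] at this
      refine ⟨μ⁻¹, Ψ, ⟨⟨Ψ, hΨ, ?_⟩, ?_⟩, hΨ, hoverlap, ?_⟩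
      -- The overlap of `Ξ₀` with its own projection `√σ Ψ` is `‖√σ Ψ‖²`.
      · rw [← hoverlap Ψ hΨ, overlap_eq_inner hA Ψ (hA Ψ.fst)]
        exact inner_self_ne_zero.2 (hAne hΨ)
      · rintro E ⟨Ψ', hΨ', hne'⟩
        rw [overlap_eq_inner hA Ψ' hξ] at hne'
        exact inv_le_of_inv_le₀ (hpos E Ψ' hΨ') (hmax _ _ (heig hΨ') hne')
      · refine convergesToMode_of_geometric hker hS hσ hσm hA hpow (inv_pos.2 hμ) hΨ hr0 hr1
          (C := C) ?_
        rw [hAΨ]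
        exact hb
    refine ⟨fun p => ⟨hmem p, hG.2.1 _ ?_⟩, hlimit, ?_⟩
    · refine (memLp_congr_ae ?_).1 (Lp.memLp (A ((weightedSolver S A ^ p) ξ)))
      filter_upwards [hA ((weightedSolver S A ^ p) ξ), hpow p] with x h1 h2
      rw [h1, h2]
    intro E₀ Ψ₀ hleast hΨ₀ hne
    have hΞne : ¬ Ξ₀ =ᵐ[vol Ω] 0 := by
      intro h0
      refine hne ?_
      have : overlap Ω σ Ψ₀ Ξ₀ = ∫ x in Ω, (0 : ℝ) := by
        refine integral_congr_ae ?_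
        filter_upwards [h0] with x hx
        rw [hx, Pi.zero_apply, mul_zero]
      rw [this, integral_zero]
    obtain ⟨E, Ψ, hE, hΨ, hoverlap, hconv⟩ := hlimit hΞne
    -- `E ≤ E₀` since `Ψ₀` overlaps `Ξ₀`, and `E₀ ≤ E` since `E` is an eigenvalue.
    obtain rfl : E = E₀ := le_antisymm (hE.2 ⟨Ψ₀, hΨ₀, hne⟩) (hleast.2 ⟨Ψ, hΨ⟩)
    refine ⟨⟨Ψ, hΨ, hconv⟩, fun hunique hnorm => ?_⟩
    obtain ⟨c, rfl⟩ := hunique Ψ hΨ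
    have hfst : (c • Ψ₀).fst =ᵐ[vol Ω] fun x => c * Ψ₀.fst x := Lp.coeFn_smul c Ψ₀.fst
    have hunit : inner ℝ (A Ψ₀.fst) (A Ψ₀.fst) = (1 : ℝ) := by
      rw [inner_mul_operator_comm hA, L2_inner_eq_integral_mul, ← hnorm]
      refine integral_congr_ae ?_
      filter_upwards [coeFn_mul_operator_twice hσ hA Ψ₀.fst] with x hx
      rw [hx]
      ring
    have hc : c = overlap Ω σ Ψ₀ Ξ₀ := by
      rw [← hoverlap Ψ₀ hΨ₀, overlap_eq_inner hA Ψ₀ (hA (c • Ψ₀).fst), WithLp.smul_fst, map_smul,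
        inner_smul_right, hunit, mul_one]
    rw [← hc]
    rw [← hc] at hne
    have hconv' := hconv.congr hfst
    refine ⟨hconv', ?_⟩
    -- The normalized limit is `c Ψ₀ / |c|`, and the factor `sign c` removes the remaining sign.
    have hl2 : l2norm Ω (fun y => √(σ y) * (c * Ψ₀.fst y)) = |c| := by
      have h1 : (A (c • Ψ₀.fst)) =ᵐ[vol Ω] fun y => √(σ y) * (c * Ψ₀.fst y) := by
        filter_upwards [hA (c • Ψ₀.fst), Lp.coeFn_smul c Ψ₀.fst] with x h2 h3
        rw [h2, h3, Pi.smul_apply, smul_eq_mul]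
      have h2 : ‖A Ψ₀.fst‖ = 1 := by
        rw [real_inner_self_eq_norm_sq] at hunit
        exact (pow_eq_one_iff_of_nonneg (norm_nonneg _) two_ne_zero).1 hunit
      rw [l2norm_eq_norm h1, map_smul, norm_smul, h2, mul_one, Real.norm_eq_abs]
    have h4 := hconv'.2.2.2
    rw [hl2] at h4
    have hlim : MemLp (fun x => c * Ψ₀.fst x / |c|) 2 (vol Ω) := by
      simp only [div_eq_mul_inv]
      exact ((Lp.memLp Ψ₀.fst).const_mul c).mul_const |c|⁻¹
    have h5 := h4.mul_tendsto hlim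
      (fun p => (((hmem p).1.aemeasurable.div hσm.sqrt).div_const _).aestronglyMeasurable)
      (tendsto_const_nhds (x := Real.sign c))
    refine h5.congr (fun _ => .rfl) (ae_of_all _ fun x => ?_)
    simp only
    rcases lt_or_gt_of_ne hne with h | h
    · rw [Real.sign_of_neg h, abs_of_neg h]
      field_simp
    · rw [Real.sign_of_pos h, abs_of_pos h]
      field_simp
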